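/- Let $K$ be a field of characteristic $0$. For $n\ge 0$ let $KS_n$ be the group algebra of the symmetric group $S_n$ (products $\pi\sigma$ are read from left to right: first $\pi$, then $\sigma$), and let $KS=\bigoplus_{n\ge 0}KS_n$. The inner product $\varphi\cdot\psi$ on $KS$ is the product of $KS_n$ on each $KS_n$, with $KS_n\cdot KS_m=0$ for $n\ne m$. The outer product $\star$ is the bilinear map for which $\alpha\star\beta$, $\alpha\in S_n$, $\beta\in S_m$, is the sum of all $\pi\in S_{n+m}$ whose word $1\pi,\dots,(n+m)\pi$ is a concatenation $uv$, where $u$ has length $n$ and standardization $\alpha$, and $v$ has standardization $\beta$; its identity is the empty permutation $\emptyset\in S_0$. The coproduct $\downarrow$ is the linear map which sends $\pi\in S_n$ to $\sum_{k=0}^n \pi_{\le k}\otimes \mathrm{st}(\pi_{>k})$, where $\pi_{\le k}$ and $\pi_{>k}$ are the subwords of the letters $\le k$ and $>k$ of $\pi$; its counit is the coefficient of $\emptyset$. For $\pi\in S_n$ let $\mathsf{Des}(\pi)=\{i: 1\le i\le n-1,\ i\pi>(i+1)\pi\}$ and $\mathsf{Peak}(\pi)=\{i: 2\le i\le n-1,\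 (i-1)\pi<i\pi>(i+1)\pi\}$, and put $\Delta^D=\sum_{\mathsf{Des}(\pi)=D}\pi$ for $D\subseteq\{1,\dots,n-1\}$ and $\Pi^P=\sum_{\mathsf{Peak}(\pi)=P}\pi$ for $P\subseteq\{2,\dots,n-1\}$. Let $\mathcal D_n$ be the linear span of all $\Delta^D$ and $\mathcal P_n$ the linear span of all $\Pi^P$ in $KS_n$; let $\mathcal D=\bigoplus_{n\ge 0}\mathcal D_n$ and $\mathcal P=\bigoplus_{n\ge 0}\mathcal P_n$. For a composition $q=(q_1,\dots,q_k)$ of $n$ let $D(q)=\{q_1,q_1+q_2,\dots,q_1+\cdots+q_{k-1}\}$ and $\Xi^q=\sum_{E\subseteq D(q)}\Delta^E$. Finally let $\tilde\Xi^0=\emptyset$, $\tilde\Xi^n=2\,\Pi^\emptyset\in\mathcal P_n$ for $n\ge 1$, $\tilde\Xi^q=\tilde\Xi^{q_1}\star\cdots\star\tilde\Xi^{q_k}$, and $\tilde\Xi=\sum_{n\ge 0}\tilde\Xi^n$ (a formal sum). Then $(\mathcal D,\star,\downarrow)$ and $(\mathcal P,\star,\downarrow)$ are graded bialgebras, and inner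 right multiplication with $\tilde\Xi$, that is $\varphi=\sum_n\varphi_n\mapsto\sum_n\varphi_n\tilde\Xi^n$ with $\varphi_n\in\mathcal D_n$, is a graded epimorphism of bialgebras $(\mathcal D,\star,\downarrow)\to(\mathcal P,\star,\downarrow)$. In particular, $\mathcal P_n=\mathcal D_n\tilde\Xi^n$ is a left ideal of the algebra $\mathcal D_n$ for all $n\ge 0$. Furthermore, $\tilde\Xi^q=\Xi^q\tilde\Xi^n$ for all $n\ge 0$ and all compositions $q$ of $n$. -/

import Mathlib

open scoped TensorProduct

universe u

noncomputable section

namespace PeakAlgebra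

/-! Positions and letters of a permutation of `{1, ..., n}` are numbered from `1` in the sets
`desSet` and `peakSet` below, whereas `Equiv.Perm (Fin n)` numbers them from `0`: the position `i`
is represented by the element of `Fin n` with value `i - 1`. -/

/-- `Des(π) = {i | 1 ≤ i ≤ n - 1, iπ > (i+1)π}`. -/
def desSet {n : ℕ} (π : Equiv.Perm (Fin n)) : Finset ℕ :=
  {i ∈ Finset.Icc 1 (n - 1) | ∃ a b : Fin n,
    (a : ℕ) + 1 = i ∧ (b : ℕ) + 1 = i + 1 ∧ π b < π a}

/-- `Peak(π) = {i | 2 ≤ i ≤ n - 1, (i-1)π < iπ > (i+1)π}`. -/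
def peakSet {n : ℕ} (π : Equiv.Perm (Fin n)) : Finset ℕ :=
  {i ∈ Finset.Icc 2 (n - 1) | ∃ a b c : Fin n,
    (a : ℕ) + 1 = i - 1 ∧ (b : ℕ) + 1 = i ∧ (c : ℕ) + 1 = i + 1 ∧ π a < π b ∧ π c < π b}

variable (K : Type u) [Field K]

/-- `KS`, the direct sum of all group algebras `K S_n`, `n ≥ 0`, as the vector space with basis the
disjoint union of all `S_n`. -/
abbrev KS : Type u := (Σ n : ℕ, Equiv.Perm (Fin n)) →₀ K

/-- A permutation as an element of `KS`. -/
def ofPerm {n : ℕ} (π : Equiv.Perm (Fin n)) : KS K := Finsupp.single ⟨n, π⟩ 1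

/-- The inner product of `KS`: for `α ∈ S_n` and `β ∈ S_m` it is the product `αβ` if `n = m`, and
`0` otherwise. Products of permutations are read from left to right: first `α`, then `β`. -/
def innerProd : KS K →ₗ[K] KS K →ₗ[K] KS K :=
  Finsupp.linearCombination K fun p : Σ n : ℕ, Equiv.Perm (Fin n) =>
    Finsupp.linearCombination K fun q : Σ n : ℕ, Equiv.Perm (Fin n) =>
      if h : q.1 = p.1 then ofPerm K ((finCongr h).permCongr q.2 * p.2) else 0

/-- The standardization of the factor of length `k` of the word `1π, 2π, ..., nπ` that begins after
the first `s` positions is `α`: the letters in that factor are ordered as those of `α`. -/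
def HasFactor {n k : ℕ} (π : Equiv.Perm (Fin n)) (s : ℕ) (α : Equiv.Perm (Fin k)) : Prop :=
  ∀ (a b : Fin n) (c d : Fin k), (a : ℕ) = s + c → (b : ℕ) = s + d → (π a < π b ↔ α c < α d)

/-- The standardization of the subword of `1π, 2π, ..., nπ` that consists of the `k` letters
`s + 1, ..., s + k` is `σ`: these letters occur in `π` in the same order as `1, ..., k` in `σ`. -/
def HasSubword {n k : ℕ} (π : Equiv.Perm (Fin n)) (s : ℕ) (σ : Equiv.Perm (Fin k)) : Prop :=
  ∀ (a b : Fin n) (c d : Fin k), (a : ℕ) = s + c → (b : ℕ) = s + d →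
    (π.symm a < π.symm b ↔ σ.symm c < σ.symm d)

open Classical in
/-- The outer product (convolution) of Malvenuto and Reutenauer: for `α ∈ S_n` and `β ∈ S_m` it is
the sum of all `π ∈ S_{n+m}` whose word is `uv` with `u` of length `n`, `st(u) = α`,
`st(v) = β`. -/
def outerProd : KS K →ₗ[K] KS K →ₗ[K] KS K :=
  Finsupp.linearCombination K fun p : Σ n : ℕ, Equiv.Perm (Fin n) =>
    Finsupp.linearCombination K fun q : Σ n : ℕ, Equiv.Perm (Fin n) =>
      ∑ π : Equiv.Perm (Fin (p.1 + q.1)) with HasFactor π 0 p.2 ∧ HasFactor π p.1 q.2, ofPerm K π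

/-- The empty permutation, the identity of the outer product. -/
def outerOne : KS K := ofPerm K (1 : Equiv.Perm (Fin 0))

open Classical in
/-- The coproduct of Malvenuto and Reutenauer: `π ∈ S_n` is mapped to the sum, over `0 ≤ k ≤ n`, of
`σ ⊗ τ` with `σ ∈ S_k` the subword of the letters `≤ k` of `π`, and `τ ∈ S_{n-k}` the
standardization of the subword of the letters `> k`. -/
def coprod : KS K →ₗ[K] KS K ⊗[K] KS K :=
  Finsupp.linearCombination K fun p : Σ n : ℕ, Equiv.Perm (Fin n) =>
    ∑ k ∈ Finset.range (p.1 + 1),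
      ∑ στ : Equiv.Perm (Fin k) × Equiv.Perm (Fin (p.1 - k))
        with HasSubword p.2 0 στ.1 ∧ HasSubword p.2 k στ.2,
        ofPerm K στ.1 ⊗ₜ[K] ofPerm K στ.2

/-- The counit that belongs to the coproduct: the coefficient of the empty permutation. -/
def counitMap : KS K →ₗ[K] K :=
  Finsupp.linearCombination K fun p : Σ n : ℕ, Equiv.Perm (Fin n) => if p.1 = 0 then 1 else 0

/-- `Δ^D ∈ K S_n`, the sum of all permutations with descent set `D`. -/
def descentSum (n : ℕ) (D : Finset ℕ) : KS K :=
  ∑ π : Equiv.Perm (Fin n) with desSet π = D, ofPerm K π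

/-- `Π^P ∈ K S_n`, the sum of all permutations with peak set `P`. -/
def peakSum (n : ℕ) (P : Finset ℕ) : KS K :=
  ∑ π : Equiv.Perm (Fin n) with peakSet π = P, ofPerm K π

/-- `𝒟_n`, the descent algebra of `S_n`: the linear span of all `Δ^D`, `D ⊆ {1, ..., n-1}`. -/
def descentAlg (n : ℕ) : Submodule K (KS K) :=
  Submodule.span K (descentSum K n '' {D | D ⊆ Finset.Icc 1 (n - 1)})

/-- `𝒫_n`, the peak algebra of `S_n`: the linear span of all `Π^P`, `P ⊆ {2, ..., n-1}`. -/
def peakAlg (n : ℕ) : Submodule K (KS K) :=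
  Submodule.span K (peakSum K n '' {P | P ⊆ Finset.Icc 2 (n - 1)})

/-- `D(q) = {q_1, q_1 + q_2, ..., q_1 + ... + q_{k-1}}` for a composition `q = q_1. ... .q_k`. -/
def partialSums {n : ℕ} (q : Composition n) : Finset ℕ :=
  (Finset.Ico 1 q.length).image q.sizeUpTo

/-- `Ξ^q = ∑_{E ⊆ D(q)} Δ^E`. -/
def Xi {n : ℕ} (q : Composition n) : KS K :=
  ∑ E ∈ (partialSums q).powerset, descentSum K n E

/-- `Ξ̃^n = 2 Π^∅ ∈ 𝒫_n` for `n ≥ 1`, and `Ξ̃^0` is the empty permutation. -/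
def tXiNat (n : ℕ) : KS K :=
  if n = 0 then outerOne K else (2 : K) • peakSum K n ∅

/-- `Ξ̃^q = Ξ̃^{q_1} ⋆ ⋯ ⋆ Ξ̃^{q_k}` for a composition `q = q_1. ... .q_k`. -/
def tXi {n : ℕ} (q : Composition n) : KS K :=
  (q.blocks.map (tXiNat K)).foldr (fun x y => outerProd K x y) (outerOne K)

/-- Inner right multiplication with the formal series `∑_{n ≥ 0} α_n`, where `α_n ∈ K S_n`:
`φ = ∑ φ_n` is mapped to `∑ φ_n α_n`. -/
def rightMul (α : ℕ → KS K) : KS K →ₗ[K] KS K :=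
  Finsupp.linearCombination K fun p : Σ n : ℕ, Equiv.Perm (Fin n) =>
    innerProd K (ofPerm K p.2) (α p.1)

/-- The linear map `e` identifies the bialgebra `A` with the sum of the subspaces `V n` of `KS`,
equipped with the restrictions of the outer product, the coproduct, the identity and the counit
of `KS`; this sum is direct and the `V n` are a grading of this bialgebra. -/
structure IsGradedBialgebra (V : ℕ → Submodule K (KS K)) (A : Type u) [Ring A] [Bialgebra K A]
    (e : A →ₗ[K] KS K) : Prop where
  injective : Function.Injective e
  range_eq : LinearMap.range e = ⨆ n, V n
  map_one : e 1 = outerOne K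
  map_mul : ∀ a b : A, e (a * b) = outerProd K (e a) (e b)
  map_comul : ∀ a : A, TensorProduct.map e e (Coalgebra.comul (R := K) a) = coprod K (e a)
  map_counit : ∀ a : A, Coalgebra.counit (R := K) a = counitMap K (e a)
  direct : iSupIndep V
  one_mem : outerOne K ∈ V 0
  mul_mem : ∀ i j : ℕ, ∀ x ∈ V i, ∀ y ∈ V j, outerProd K x y ∈ V (i + j)
  comul_mem : ∀ n : ℕ, ∀ x ∈ V n, coprod K x ∈
    ⨆ p ∈ Finset.HasAntidiagonal.antidiagonal n, LinearMap.range (TensorProduct.mapIncl (V p.1) (V p.2))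
  counit_eq_zero : ∀ n : ℕ, n ≠ 0 → ∀ x ∈ V n, counitMap K x = 0

/-- `R` is a subalgebra (with identity) of the group algebra `K S_n` and `I` is a left ideal
of `R`. -/
structure IsLeftIdealOf (n : ℕ) (I R : Submodule K (KS K)) : Prop where
  one_mem : ofPerm K (1 : Equiv.Perm (Fin n)) ∈ R
  mul_mem : ∀ x ∈ R, ∀ y ∈ R, innerProd K x y ∈ R
  le : I ≤ R
  smul_mem : ∀ x ∈ R, ∀ y ∈ I, innerProd K x y ∈ I

end PeakAlgebra

end

/-! An element of `KS` is read as a function on words without repeated letters: its value at a word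
is the coefficient of the standardization (`val`). In this picture all three structures become
operations on words. The outer product is the convolution dual to deconcatenation (`val_outerProd`).
The coproduct evaluates on shuffles (`coprod_apply`). Inner left multiplication with a permutation
rearranges the positions of a word (`val_innerProd_ofPerm`), so left multiplication with `α ⋆ β`
evaluates on all shuffles of two rearranged factors (`sum_hasFactor_eq_shuffleSum`).

Suppose that the values of `x` on shuffles of `u` and `v` are given by a tensor `∑ x₁ ⊗ x₂`,
whatever the relative size of the letters of `u` and `v` (`IsSplit`). Then this tensor is the
coproduct of `x`, and `(y ⋆ y') · x = ∑ (y · x₁) ⋆ (y' · x₂)` for all `y`, `y'`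
(`IsSplit.inner_mul`). A series `∑ t n` is group-like in this sense if it is multiplicative on
shuffles. Right multiplication with it is then an endomorphism of the outer algebra which sends the
identity of `S_n` to `t n`. The subalgebra generated by the `t n` is a bialgebra, because its axioms
need only be checked on the generators.

Two series matter. The identity permutations give the indicator of increasing words, which is
multiplicative on shuffles. The series `Ξ̃` is the convolution of the indicators of decreasing and
of increasing words: a nonempty word without peaks falls to its minimum and then rises, and can be
cut on either side of the minimum, whence the factor 2 (`conv_dec_inc`). Convolutions of shuffle
characters are shuffle characters, so `Ξ̃` is group-like too.

Finally, the two generated subalgebras are `𝒟` and `𝒫`, by triangularity: products of identities are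
sums of `Δ^E` over sets `E` of cuts, and products of `Ξ̃^n` are nonzero multiples of sums of `Π^E`
over sets `E` whose elements lie next to cuts (`wordSpan_idFamily`, `wordSpan_tXiFamily`). Solomon's
theorem follows from the same splitting formula, and the left ideal property from associativity. -/

noncomputable section

namespace PeakAlgebra

/-! ### Shuffles, convolution and shuffle characters -/

section Words

variable {α : Type*} {R : Type*} [CommSemiring R]

/-- The list of all shuffles of two words. -/
def shuffles : List α → List α → List (List α)
  | [], v => [v]
  | a :: u, [] => [a :: u]
  | a :: u, b :: v =>
    (shuffles u (b :: v)).map (fun l => a :: l) ++ (shuffles (a :: u) v).map (fun l => b :: l)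
termination_by u v => u.length + v.length

/-- The value of a linear functional on the shuffle product of two words. -/
def shuffleSum (F : List α → R) (u v : List α) : R := ((shuffles u v).map F).sum

/-- The convolution of two linear functionals on words, dual to deconcatenation. -/
def conv (F G : List α → R) (w : List α) : R :=
  ∑ i ∈ Finset.range (w.length + 1), F (w.take i) * G (w.drop i)

theorem shuffles_nil_right (u : List α) : shuffles u [] = [u] := by
  cases u <;> simp [shuffles]

theorem shuffleSum_nil_left (F : List α → R) (v : List α) : shuffleSum F [] v = F v := by
  simp [shuffleSum, shuffles]

theorem shuffleSum_nil_right (F : List α → R) (u : List α) : shuffleSum F u [] = F u := by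
  simp [shuffleSum, shuffles_nil_right]

theorem shuffleSum_cons_cons (F : List α → R) (a b : α) (u v : List α) :
    shuffleSum F (a :: u) (b :: v) =
      shuffleSum (fun l => F (a :: l)) u (b :: v) + shuffleSum (fun l => F (b :: l)) (a :: u) v := by
  simp [shuffleSum, shuffles, Function.comp_def]

theorem shuffleSum_add (F G : List α → R) (u v : List α) :
    shuffleSum (fun l => F l + G l) u v = shuffleSum F u v + shuffleSum G u v :=
  List.sum_map_add

theorem shuffleSum_mul_left (c : R) (F : List α → R) (u v : List α) :
    shuffleSum (fun l => c * F l) u v = c * shuffleSum F u v :=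
  List.sum_map_mul_left ..

theorem conv_cons (F G : List α → R) (a : α) (w : List α) :
    conv F G (a :: w) = F [] * G (a :: w) + conv (fun l => F (a :: l)) G w := by
  simp only [conv, List.length_cons]
  rw [Finset.sum_range_succ' _ (w.length + 1), add_comm]
  simp

theorem conv_nil (F G : List α → R) : conv F G [] = F [] * G [] := by
  simp [conv]

/-- Cutting a shuffle of `u` and `v` in two yields a shuffle of prefixes and a shuffle of the
remaining suffixes, and each such pair arises once: deconcatenation is multiplicative for the
shuffle product. -/
theorem shuffleSum_conv (F G : List α → R) (u v : List α) :
    shuffleSum (conv F G) u v =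
      ∑ i ∈ Finset.range (u.length + 1), ∑ j ∈ Finset.range (v.length + 1),
        shuffleSum F (u.take i) (v.take j) * shuffleSum G (u.drop i) (v.drop j) := by
  induction u, v using shuffles.induct generalizing F with
  | case1 v => simp [shuffleSum_nil_left, conv]
  | case2 a u => simp [shuffleSum_nil_right, conv]
  | case3 a u b v ih1 ih2 =>
    rw [shuffleSum_cons_cons]
    simp only [conv_cons]
    rw [shuffleSum_add, shuffleSum_add, shuffleSum_mul_left, shuffleSum_mul_left, ih1, ih2]
    simp only [List.length_cons]
    rw [Finset.sum_range_succ' _ (u.length + 1), Finset.sum_range_succ' _ (u.length + 1)]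
    simp only [Finset.sum_range_succ' _ (v.length + 1), List.take_succ_cons, List.drop_succ_cons,
      List.take_zero, List.drop_zero, shuffleSum_nil_left, shuffleSum_nil_right,
      shuffleSum_cons_cons, Finset.sum_add_distrib, add_mul, mul_add]
    ring

/-- Linear functionals that are multiplicative on shuffles of words without common letters. -/
def IsShuffleChar (F : List α → R) : Prop :=
  ∀ u v : List α, (u ++ v).Nodup → shuffleSum F u v = F u * F v

theorem IsShuffleChar.conv {F G : List α → R} (hF : IsShuffleChar F) (hG : IsShuffleChar G) :
    IsShuffleChar (conv F G) := by
  intro u v h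
  rw [shuffleSum_conv, PeakAlgebra.conv, PeakAlgebra.conv, Finset.sum_mul_sum]
  refine Finset.sum_congr rfl fun i _ => Finset.sum_congr rfl fun j _ => ?_
  rw [hF _ _ (h.sublist ((List.take_sublist _ _).append (List.take_sublist _ _))),
    hG _ _ (h.sublist ((List.drop_sublist _ _).append (List.drop_sublist _ _)))]
  ring

theorem perm_of_mem_shuffles {u v l : List α} (h : l ∈ shuffles u v) : l.Perm (u ++ v) := by
  induction u, v using shuffles.induct generalizing l with
  | case1 v => simp [shuffles] at h; simp [h]
  | case2 a u => simp [shuffles] at h; simp [h]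
  | case3 a u b v ih1 ih2 =>
    simp only [shuffles, List.mem_append, List.mem_map] at h
    rcases h with ⟨l, hl, rfl⟩ | ⟨l, hl, rfl⟩
    · exact (ih1 hl).cons a
    · exact ((ih2 hl).cons b).trans List.perm_middle.symm

theorem shuffleSum_congr {F G : List α → R} {u v : List α}
    (h : ∀ l : List α, l.Perm (u ++ v) → F l = G l) : shuffleSum F u v = shuffleSum G u v := by
  unfold shuffleSum
  congr 1
  exact List.map_congr_left fun l hl => h l (perm_of_mem_shuffles hl)

open Classical in
-- Two sorted words without common letters have exactly one sorted shuffle, and an unsorted word has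
-- only unsorted shuffles. The order is arbitrary because both `<` and `>` are needed.
theorem isShuffleChar_pairwise (r : α → α → Prop) [IsStrictTotalOrder α r] :
    IsShuffleChar (fun l : List α => if l.Pairwise r then (1 : R) else 0) := by
  intro u v h
  induction u, v using shuffles.induct with
  | case1 v => simp [shuffleSum_nil_left]
  | case2 a u => simp [shuffleSum_nil_right]
  | case3 a u b v ih1 ih2 =>
    have key : ∀ (c : α) (x y : List α),
        shuffleSum (fun l => if (c :: l).Pairwise r then (1 : R) else 0) x y =
          (if ∀ z ∈ x ++ y, r c z then 1 else 0) *
            shuffleSum (fun l => if l.Pairwise r then (1 : R) else 0) x y := by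
      intro c x y
      rw [← shuffleSum_mul_left]
      refine shuffleSum_congr fun l hl => ?_
      simp only [List.pairwise_cons, hl.mem_iff, ite_and, ite_mul, one_mul, zero_mul]
    have h1 : (u ++ b :: v).Nodup := (List.nodup_cons.1 h).2
    have h2 : (a :: u ++ v).Nodup := (List.nodup_middle.1 h |> List.nodup_cons.1).2
    have hab : a ≠ b := by
      rintro rfl
      simp at h
    rw [shuffleSum_cons_cons, key, key, ih1 h1, ih2 h2]
    simp only [List.pairwise_cons, List.mem_append, List.mem_cons]
    have tr : ∀ x y z, r x y → r y z → r x z := fun x y z => _root_.trans_of r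
    have asy : ∀ x y, r x y → ¬ r y x := fun x y => _root_.asymm_of r
    -- A sorted shuffle starts with the smaller of `a` and `b`, so one of the two summands vanishes.
    rcases trichotomous_of r a b with hr | hr | hr
    · have e2 : ¬ ∀ z, ((z = a ∨ z ∈ u) ∨ z ∈ v) → r b z := fun H =>
        asy _ _ hr (H a (Or.inl (Or.inl rfl)))
      rw [if_neg e2, zero_mul, add_zero]
      by_cases hb : (∀ z ∈ v, r b z) ∧ v.Pairwise r
      · have e1 : (∀ z, (z ∈ u ∨ z = b ∨ z ∈ v) → r a z) ↔ ∀ z ∈ u, r a z :=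
          ⟨fun H z hz => H z (Or.inl hz), fun H z hz => by
            rcases hz with hz | rfl | hz
            · exact H z hz
            · exact hr
            · exact tr _ _ _ hr (hb.1 z hz)⟩
        rw [if_pos hb, e1, mul_one, mul_one]
        split_ifs <;> simp_all
      · rw [if_neg hb]; simp
    · exact absurd hr hab
    · have e2 : ¬ ∀ z, (z ∈ u ∨ z = b ∨ z ∈ v) → r a z := fun H =>
        asy _ _ hr (H b (Or.inr (Or.inl rfl)))
      rw [if_neg e2, zero_mul, zero_add]
      by_cases hb : (∀ z ∈ u, r a z) ∧ u.Pairwise r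
      · have e1 : (∀ z, ((z = a ∨ z ∈ u) ∨ z ∈ v) → r b z) ↔ ∀ z ∈ v, r b z :=
          ⟨fun H z hz => H z (Or.inr hz), fun H z hz => by
            rcases hz with (rfl | hz) | hz
            · exact hr
            · exact tr _ _ _ hr (hb.1 z hz)
            · exact H z hz⟩
        rw [if_pos hb, e1, one_mul, one_mul]
        split_ifs <;> simp_all
      · rw [if_neg hb]; simp

/-- This description without recursion is the one that can be compared with conditions on the
factors of a permutation. -/
theorem mem_shuffles {u v : List α} (h : (u ++ v).Nodup) {l : List α} :
    l ∈ shuffles u v ↔ l.Perm (u ++ v) ∧ u.Sublist l ∧ v.Sublist l := by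
  induction u, v using shuffles.induct generalizing l with
  | case1 v =>
    simp only [shuffles, List.mem_singleton, List.nil_append, List.nil_sublist, true_and]
    exact ⟨fun e => e ▸ ⟨.refl _, .refl _⟩, fun e => (e.2.eq_of_length e.1.length_eq.symm).symm⟩
  | case2 a u =>
    simp only [shuffles, List.mem_singleton, List.append_nil, List.nil_sublist, and_true]
    exact ⟨fun e => e ▸ ⟨.refl _, .refl _⟩, fun e => (e.2.eq_of_length e.1.length_eq.symm).symm⟩
  | case3 a u b v ih1 ih2 =>
    have h1 : (u ++ b :: v).Nodup := (List.nodup_cons.1 h).2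
    have h2 : (a :: u ++ v).Nodup := (List.nodup_middle.1 h |> List.nodup_cons.1).2
    have hab : a ≠ b := by
      rintro rfl
      simp at h
    simp only [shuffles, List.mem_append, List.mem_map]
    constructor
    · rintro (⟨l, hl, rfl⟩ | ⟨l, hl, rfl⟩)
      · obtain ⟨p, q, r⟩ := (ih1 h1).1 hl
        exact ⟨p.cons a, q.cons_cons a, r.cons a⟩
      · obtain ⟨p, q, r⟩ := (ih2 h2).1 hl
        exact ⟨(p.cons b).trans List.perm_middle.symm, q.cons b, r.cons_cons b⟩
    · rintro ⟨p, q, r⟩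
      cases l with
      | nil => simp at p
      | cons c l =>
        have hn : (c :: l).Nodup := p.nodup_iff.2 h
        by_cases hca : c = a
        · subst hca
          refine Or.inl ⟨l, (ih1 h1).2 ⟨p.cons_inv, List.cons_sublist_cons.1 q, ?_⟩, rfl⟩
          cases r with
          | cons _ r => exact r
          | cons_cons _ r => exact absurd rfl hab
        · have q' : (a :: u).Sublist l := by
            cases q with
            | cons _ r => exact r
            | cons_cons _ r => exact absurd rfl hca
          by_cases hcb : c = b
          · subst hcb
            exact Or.inr ⟨l, (ih2 h2).2
              ⟨(p.trans List.perm_middle).cons_inv, q', List.cons_sublist_cons.1 r⟩, rfl⟩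
          · have r' : (b :: v).Sublist l := by
              cases r with
              | cons _ r => exact r
              | cons_cons _ r => exact absurd rfl hcb
            have : c ∈ a :: u ++ b :: v := p.subset (by simp)
            rcases List.mem_append.1 this with hc | hc
            · exact absurd (q'.subset hc) (List.nodup_cons.1 hn).1
            · exact absurd (r'.subset hc) (List.nodup_cons.1 hn).1

theorem nodup_shuffles {u v : List α} (h : (u ++ v).Nodup) : (shuffles u v).Nodup := by
  induction u, v using shuffles.induct with
  | case1 v => simp [shuffles]
  | case2 a u => simp [shuffles]
  | case3 a u b v ih1 ih2 =>
    have h1 : (u ++ b :: v).Nodup := (List.nodup_cons.1 h).2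
    have h2 : (a :: u ++ v).Nodup := (List.nodup_middle.1 h |> List.nodup_cons.1).2
    have hab : a ≠ b := by
      rintro rfl
      simp at h
    rw [shuffles, List.nodup_append]
    refine ⟨(ih1 h1).map (List.cons_injective), (ih2 h2).map (List.cons_injective), ?_⟩
    intro x hx y hy e
    obtain ⟨x, -, rfl⟩ := List.mem_map.1 hx
    obtain ⟨y, -, rfl⟩ := List.mem_map.1 hy
    exact hab (List.cons.inj e).1

theorem ofFn_append_split {n m : ℕ} (w : Fin (n + m) → α) :
    List.ofFn w = List.ofFn (fun i => w (Fin.castAdd m i)) ++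
      List.ofFn (fun i => w (Fin.natAdd n i)) := by
  rw [← List.ofFn_fin_append]
  congr 1
  exact (Fin.append_castAdd_natAdd (f := w)).symm

/-- Reading `w` along `π.symm` moves the letter number `i` to position `π i`. Hence the rearranged
factor is a subword exactly if `π` increases along `ι ∘ γ.symm`, that is, if `π` orders the factor
as `γ` does. -/
theorem sublist_ofFn_iff {k N : ℕ} (w : Fin N → α) (hw : Function.Injective w)
    (π : Equiv.Perm (Fin N)) (s : ℕ) (ι : Fin k → Fin N) (hι : ∀ c, (ι c : ℕ) = s + c)
    (γ : Equiv.Perm (Fin k)) :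
    (List.ofFn fun i => w (ι (γ.symm i))).Sublist (List.ofFn fun i => w (π.symm i)) ↔
      HasFactor π s γ := by
  have main : HasFactor π s γ ↔ StrictMono fun c => π (ι (γ.symm c)) := by
    constructor
    · intro h c d hcd
      exact (h _ _ (γ.symm c) (γ.symm d) (hι _) (hι _)).2 (by simpa using hcd)
    · intro h a b c d ha hb
      have ea : a = ι c := Fin.ext (by rw [ha, hι])
      have eb : b = ι d := Fin.ext (by rw [hb, hι])
      subst ea eb
      simpa using h.lt_iff_lt (a := γ c) (b := γ d)
  rw [main, List.sublist_iff_exists_fin_orderEmbedding_get_eq]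
  constructor
  · rintro ⟨f, hf⟩ c d hcd
    have key : ∀ c : Fin k, (f ⟨c, by simp⟩ : ℕ) = π (ι (γ.symm c)) := by
      intro c
      have := hf ⟨c, by simp⟩
      simp only [List.get_eq_getElem, List.getElem_ofFn] at this
      have := hw this
      rw [Equiv.eq_symm_apply] at this
      rw [this]
    have : f ⟨c, by simp⟩ < f ⟨d, by simp⟩ := f.strictMono (by simpa using hcd)
    rw [Fin.lt_def, key, key] at this
    exact this
  · intro h
    refine ⟨OrderEmbedding.ofStrictMono
      (fun c => ⟨π (ι (γ.symm ⟨c, by simpa using c.2⟩)), by simp⟩) ?_, ?_⟩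
    · intro c d hcd
      exact h (a := ⟨c, by simpa using c.2⟩) (b := ⟨d, by simpa using d.2⟩) hcd
    · intro c
      simp [OrderEmbedding.ofStrictMono]

theorem exists_perm_of_perm_ofFn {N : ℕ} (w : Fin N → α) (hw : Function.Injective w) {l : List α}
    (h : l.Perm (List.ofFn w)) : ∃ π : Equiv.Perm (Fin N), l = List.ofFn fun i => w (π.symm i) := by
  have hl : l.length = N := by simpa using h.length_eq
  subst hl
  have hn : l.Nodup := h.nodup_iff.2 (List.nodup_ofFn.2 hw)
  have hm : ∀ i, ∃ j, w j = l.get i := fun i => by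
    simpa using h.subset (List.get_mem l i)
  choose f hf using hm
  have hfi : Function.Injective f := fun i j e => by
    have := congrArg w e
    rw [hf, hf] at this
    exact hn.injective_get this
  refine ⟨(Equiv.ofBijective f (Finite.injective_iff_bijective.1 hfi)).symm, ?_⟩
  have : (fun i => w ((Equiv.ofBijective f (Finite.injective_iff_bijective.1 hfi)).symm.symm i)) =
      l.get := funext hf
  rw [this, List.ofFn_get]

open Classical in
/-- The permutations `π` whose word consists of two factors with standardizations `β` and `γ`
rearrange the letters of a word to all shuffles of its rearranged factors. -/
theorem sum_hasFactor_eq_shuffleSum {n m : ℕ} (w : Fin (n + m) → α) (hw : Function.Injective w)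
    (β : Equiv.Perm (Fin n)) (γ : Equiv.Perm (Fin m)) (F : List α → R) :
    ∑ π : Equiv.Perm (Fin (n + m)) with HasFactor π 0 β ∧ HasFactor π n γ,
        F (List.ofFn fun i => w (π.symm i)) =
      shuffleSum F (List.ofFn fun i => w (Fin.castAdd m (β.symm i)))
        (List.ofFn fun i => w (Fin.natAdd n (γ.symm i))) := by
  set u := List.ofFn fun i => w (Fin.castAdd m (β.symm i)) with hu
  set v := List.ofFn fun i => w (Fin.natAdd n (γ.symm i)) with hv
  have hperm : (u ++ v).Perm (List.ofFn w) := by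
    rw [ofFn_append_split w]
    exact (Equiv.Perm.ofFn_comp_perm β.symm fun i => w (Fin.castAdd m i)).append
      (Equiv.Perm.ofFn_comp_perm γ.symm fun i => w (Fin.natAdd n i))
  have hnd : (u ++ v).Nodup := hperm.nodup_iff.2 (List.nodup_ofFn.2 hw)
  have hs := List.sum_toFinset F (nodup_shuffles hnd)
  rw [shuffleSum, ← hs]
  have su := fun π => sublist_ofFn_iff w hw π 0 (Fin.castAdd m) (by simp) β
  have sv := fun π => sublist_ofFn_iff w hw π n (Fin.natAdd n) (by simp) γ
  refine Finset.sum_bij (fun π _ => List.ofFn fun i => w (π.symm i)) ?_ ?_ ?_ ?_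
  · intro π hπ
    simp only [Finset.mem_filter, Finset.mem_univ, true_and] at hπ
    rw [List.mem_toFinset, mem_shuffles hnd]
    exact ⟨(Equiv.Perm.ofFn_comp_perm π.symm w).trans hperm.symm, (su π).2 hπ.1, (sv π).2 hπ.2⟩
  · intro π _ ρ _ e
    have := List.ofFn_injective e
    exact Equiv.symm_bijective.injective (Equiv.ext fun i => hw (congrFun this i))
  · intro l hl
    rw [List.mem_toFinset, mem_shuffles hnd] at hl
    obtain ⟨π, rfl⟩ := exists_perm_of_perm_ofFn w hw (hl.1.trans hperm)
    exact ⟨π, by simpa using ⟨(su π).1 hl.2.1, (sv π).1 hl.2.2⟩, rfl⟩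
  · intro _ _
    rfl

end Words

/-! ### Elements of `KS` as functions on words -/

section Values

/-- The word `w` has the standardization `p`. -/
def IsPattern (p : Σ n : ℕ, Equiv.Perm (Fin n)) (w : List ℕ) : Prop :=
  ∃ g : Fin p.1 → ℕ, w = List.ofFn g ∧ ∀ i j, (g i < g j ↔ p.2 i < p.2 j)

theorem isPattern_ofFn {n : ℕ} (π : Equiv.Perm (Fin n)) (g : Fin n → ℕ) :
    IsPattern ⟨n, π⟩ (List.ofFn g) ↔ ∀ i j, (g i < g j ↔ π i < π j) := by
  constructor
  · rintro ⟨g', e, h⟩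
    have := List.ofFn_injective e
    subst this
    exact h
  · exact fun h => ⟨g, rfl, h⟩

theorem IsPattern.length_eq {p : Σ n : ℕ, Equiv.Perm (Fin n)} {w : List ℕ} (h : IsPattern p w) :
    w.length = p.1 := by
  obtain ⟨g, rfl, -⟩ := h
  simp

/-- The map `ρ ∘ π.symm` is an order automorphism of `Fin n`, and the identity is the only one. -/
theorem perm_eq_of_lt_iff {n : ℕ} {π ρ : Equiv.Perm (Fin n)}
    (h : ∀ i j, π i < π j ↔ ρ i < ρ j) : π = ρ := by
  have hm : StrictMono (fun i => ρ (π.symm i)) := fun i j hij => by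
    rw [← h]; simpa using hij
  have e : (hm.orderIsoOfSurjective _ (ρ.surjective.comp π.symm.surjective)) = OrderIso.refl _ :=
    Subsingleton.elim _ _
  ext i
  have := congrArg (fun f => f (π i)) e
  simp at this
  rw [this]

theorem IsPattern.unique {p q : Σ n : ℕ, Equiv.Perm (Fin n)} {w : List ℕ} (hp : IsPattern p w)
    (hq : IsPattern q w) : p = q := by
  obtain ⟨n, π⟩ := p
  obtain ⟨m, ρ⟩ := q
  have : n = m := hp.length_eq.symm.trans hq.length_eq
  subst this
  obtain ⟨g, rfl, hg⟩ := hp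
  have hq := (isPattern_ofFn _ _).1 hq
  exact congrArg (Sigma.mk n) (perm_eq_of_lt_iff fun i j => (hg i j).symm.trans (hq i j))

theorem exists_isPattern_ofFn {n : ℕ} {g : Fin n → ℕ} (hg : Function.Injective g) :
    ∃ π : Equiv.Perm (Fin n), IsPattern ⟨n, π⟩ (List.ofFn g) := by
  refine ⟨(Tuple.sort g).symm, (isPattern_ofFn _ _).2 fun i j => ?_⟩
  have hm : StrictMono (g ∘ Tuple.sort g) :=
    (Tuple.monotone_sort g).strictMono_of_injective (hg.comp (Tuple.sort g).injective)
  rw [← hm.lt_iff_lt]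
  simp

/-- The letters of the word of `p`, increased by `s`. -/
def shiftWord (s : ℕ) (p : Σ n : ℕ, Equiv.Perm (Fin n)) : List ℕ :=
  List.ofFn fun i => s + (p.2 i : ℕ)

theorem isPattern_shiftWord (s : ℕ) (p : Σ n : ℕ, Equiv.Perm (Fin n)) :
    IsPattern p (shiftWord s p) :=
  (isPattern_ofFn _ _).2 fun i j => by simp

theorem nodup_shiftWord (s : ℕ) (p : Σ n : ℕ, Equiv.Perm (Fin n)) : (shiftWord s p).Nodup :=
  List.nodup_ofFn.2 fun i j h => p.2.injective (Fin.ext (by simpa using h))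

theorem exists_ofFn_of_nodup {w : List ℕ} {n : ℕ} (hw : w.Nodup) (hn : w.length = n) :
    ∃ g : Fin n → ℕ, Function.Injective g ∧ w = List.ofFn g := by
  subst hn
  exact ⟨w.get, hw.injective_get, (List.ofFn_get w).symm⟩

theorem exists_isPattern {w : List ℕ} (hw : w.Nodup) : ∃ p, IsPattern p w := by
  obtain ⟨π, hπ⟩ := exists_isPattern_ofFn hw.injective_get
  rw [List.ofFn_get] at hπ
  exact ⟨_, hπ⟩

theorem hasFactor_iff {k N : ℕ} (π : Equiv.Perm (Fin N)) (s : ℕ) (ι : Fin k → Fin N)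
    (hι : ∀ c, (ι c : ℕ) = s + c) (γ : Equiv.Perm (Fin k)) :
    HasFactor π s γ ↔ ∀ c d, π (ι c) < π (ι d) ↔ γ c < γ d := by
  constructor
  · exact fun h c d => h _ _ _ _ (hι c) (hι d)
  · intro h a b c d ha hb
    have ea : a = ι c := Fin.ext (by rw [ha, hι])
    have eb : b = ι d := Fin.ext (by rw [hb, hι])
    subst ea eb
    exact h c d

variable (K : Type u) [Field K]

open Classical in
/-- The coefficients of an element of `KS`, as a function of words. -/
def val : KS K →ₗ[K] (List ℕ → K) :=
  Finsupp.linearCombination K fun p w => if IsPattern p w then (1 : K) else 0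

variable {K}

theorem KS_induction {motive : KS K → Prop} (x : KS K)
    (add : ∀ x y, motive x → motive y → motive (x + y))
    (smul : ∀ (c : K) x, motive x → motive (c • x))
    (ofPerm : ∀ (n : ℕ) (π : Equiv.Perm (Fin n)), motive (ofPerm K π)) : motive x := by
  have hs : ∀ p c, motive (Finsupp.single p c) := fun p c => by
    have := smul c _ (ofPerm p.1 p.2)
    rwa [PeakAlgebra.ofPerm, Finsupp.smul_single, smul_eq_mul, mul_one] at this
  induction x using Finsupp.induction_linear with
  | zero => simpa using hs ⟨0, 1⟩ 0
  | add x y hx hy => exact add x y hx hy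
  | single p c => exact hs p c

open Classical in
theorem val_ofPerm {n : ℕ} (π : Equiv.Perm (Fin n)) (w : List ℕ) :
    val K (ofPerm K π) w = if IsPattern ⟨n, π⟩ w then 1 else 0 := by
  simp [val, ofPerm]

theorem IsPattern.val_eq {p : Σ n : ℕ, Equiv.Perm (Fin n)} {w : List ℕ} (h : IsPattern p w)
    (x : KS K) : val K x w = x p := by
  classical
  induction x using KS_induction with
  | add x y hx hy => simp [hx, hy]
  | smul c x hx => simp [hx]
  | ofPerm n π =>
    rw [val_ofPerm, ofPerm, Finsupp.single_apply]
    have : IsPattern ⟨n, π⟩ w ↔ ⟨n, π⟩ = p := ⟨fun h' => h'.unique h, fun e => e ▸ h⟩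
    simp only [this]

/-- The word of a permutation has that permutation as its pattern, so the coefficients are among the
values. Identities in `KS` thereby become identities on words. -/
theorem val_ext {x y : KS K} (h : ∀ w : List ℕ, w.Nodup → val K x w = val K y w) : x = y := by
  ext p
  have := h _ (nodup_shiftWord 0 p)
  rwa [(isPattern_shiftWord 0 p).val_eq, (isPattern_shiftWord 0 p).val_eq] at this

theorem conv_congr {α : Type*} {F F' G G' : List α → K} {w : List α} (hw : w.Nodup)
    (hF : ∀ l : List α, l.Nodup → F l = F' l) (hG : ∀ l : List α, l.Nodup → G l = G' l) :
    conv F G w = conv F' G' w :=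
  Finset.sum_congr rfl fun _ _ => by
    rw [hF _ (hw.sublist (List.take_sublist _ _)), hG _ (hw.sublist (List.drop_sublist _ _))]

theorem conv_add_left {α : Type*} (F F' G : List α → K) (w : List α) :
    conv (F + F') G w = conv F G w + conv F' G w := by
  simp [conv, add_mul, Finset.sum_add_distrib]

theorem conv_add_right {α : Type*} (F G G' : List α → K) (w : List α) :
    conv F (G + G') w = conv F G w + conv F G' w := by
  simp [conv, mul_add, Finset.sum_add_distrib]

theorem conv_smul_left {α : Type*} (c : K) (F G : List α → K) (w : List α) :
    conv (c • F) G w = c * conv F G w := by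
  simp [conv, mul_assoc, Finset.mul_sum]

theorem conv_smul_right {α : Type*} (c : K) (F G : List α → K) (w : List α) :
    conv F (c • G) w = c * conv F G w := by
  simp only [conv, Pi.smul_apply, smul_eq_mul, Finset.mul_sum]
  exact Finset.sum_congr rfl fun _ _ => by ring

theorem conv_assoc {α : Type*} (F G H : List α → K) (w : List α) :
    conv (conv F G) H w = conv F (conv G H) w := by
  induction w generalizing F with
  | nil => simp [conv_nil, mul_assoc]
  | cons a w ih =>
    have : (fun l => conv F G (a :: l)) =
        F [] • (fun l => G (a :: l)) + conv (fun l => F (a :: l)) G := by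
      ext l
      simp [conv_cons]
    rw [conv_cons, this, conv_add_left, conv_smul_left, ih, conv_cons F, conv_cons G, conv_nil]
    ring

/-- A convolution whose first factor is supported on words of length `n`. -/
theorem conv_eq_of_length {α : Type*} {F G : List α → K} {n : ℕ}
    (hF : ∀ w, w.length ≠ n → F w = 0) (u v : List α) (hu : u.length = n) :
    conv F G (u ++ v) = F u * G v := by
  rw [conv, Finset.sum_eq_single n]
  · rw [List.take_left' hu, List.drop_left' hu]
  · intro i hi hin
    rw [hF, zero_mul]
    simp at hi ⊢
    omega
  · intro h
    simp [hu] at h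

theorem val_ofPerm_of_length_ne {n : ℕ} (π : Equiv.Perm (Fin n)) {w : List ℕ} (h : w.length ≠ n) :
    val K (ofPerm K π) w = 0 := by
  rw [val_ofPerm, if_neg fun h' => h h'.length_eq]

theorem conv_eq_zero_of_length {α : Type*} {F G : List α → K} {n m : ℕ}
    (hF : ∀ w, w.length ≠ n → F w = 0) (hG : ∀ w, w.length ≠ m → G w = 0) {w : List α}
    (hw : w.length ≠ n + m) : conv F G w = 0 := by
  refine Finset.sum_eq_zero fun i hi => ?_
  simp only [Finset.mem_range] at hi
  by_cases h : i = n
  · rw [hG, mul_zero]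
    simp; omega
  · rw [hF, zero_mul]
    simp; omega

open Classical in
theorem outerProd_ofPerm {n m : ℕ} (α : Equiv.Perm (Fin n)) (β : Equiv.Perm (Fin m)) :
    outerProd K (ofPerm K α) (ofPerm K β) =
      ∑ π : Equiv.Perm (Fin (n + m)) with HasFactor π 0 α ∧ HasFactor π n β, ofPerm K π := by
  simp [outerProd, ofPerm]

/-- For permutations of degrees `n` and `m` only the cut after `n` letters contributes, and it tests
the standardizations of both factors. Words with repeated letters must be excluded: they have no
pattern, although their two factors may have one. -/
theorem val_outerProd (x y : KS K) {w : List ℕ} (hw : w.Nodup) :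
    val K (outerProd K x y) w = conv (val K x) (val K y) w := by
  classical
  induction x using KS_induction with
  | add x x' hx hx' => simp [hx, hx', conv_add_left]
  | smul c x hx => simp [hx, conv_smul_left]
  | ofPerm n α =>
    induction y using KS_induction with
    | add y y' hy hy' => simp [hy, hy', conv_add_right]
    | smul c y hy => simp [hy, conv_smul_right]
    | ofPerm m β =>
      have hα := fun (w : List ℕ) (h : w.length ≠ n) => val_ofPerm_of_length_ne (K := K) α h
      have hβ := fun (w : List ℕ) (h : w.length ≠ m) => val_ofPerm_of_length_ne (K := K) β h
      rw [outerProd_ofPerm]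
      by_cases hl : w.length = n + m
      · obtain ⟨g, hg, rfl⟩ := exists_ofFn_of_nodup hw hl
        obtain ⟨ρ, hρ⟩ := exists_isPattern_ofFn hg
        rw [hρ.val_eq, ofFn_append_split g, conv_eq_of_length hα _ _ (by simp), val_ofPerm,
          val_ofPerm, isPattern_ofFn, isPattern_ofFn, Finsupp.finsetSum_apply]
        rw [isPattern_ofFn] at hρ
        simp only [hρ, ← hasFactor_iff ρ 0 (Fin.castAdd m) (by simp) α,
          ← hasFactor_iff ρ n (Fin.natAdd n) (by simp) β]
        by_cases h : HasFactor ρ 0 α <;> simp [ofPerm, Finsupp.single_apply, h]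
      · rw [conv_eq_zero_of_length hα hβ hl]
        simp only [map_sum, Finset.sum_apply]
        exact Finset.sum_eq_zero fun π _ => val_ofPerm_of_length_ne π hl

theorem val_outerOne (w : List ℕ) : val K (outerOne K) w = if w = [] then 1 else 0 := by
  classical
  have : IsPattern ⟨0, 1⟩ w ↔ w = [] :=
    ⟨fun h => List.eq_nil_of_length_eq_zero h.length_eq,
      fun h => ⟨fun i => i.elim0, by simp [h], fun i => i.elim0⟩⟩
  rw [outerOne, val_ofPerm]
  simp only [this]

theorem innerProd_ofPerm_same {n : ℕ} (α β : Equiv.Perm (Fin n)) :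
    innerProd K (ofPerm K α) (ofPerm K β) = ofPerm K (β * α) := by
  simp [innerProd, ofPerm]
  rfl

theorem innerProd_ofPerm_ne {n m : ℕ} (h : m ≠ n) (α : Equiv.Perm (Fin n))
    (β : Equiv.Perm (Fin m)) : innerProd K (ofPerm K α) (ofPerm K β) = 0 := by
  simp [innerProd, ofPerm, h]

/-- As products are read from left to right, a left factor acts on positions and therefore
rearranges the argument, independently of `x`. -/
theorem val_innerProd_ofPerm {n : ℕ} (α : Equiv.Perm (Fin n)) (x : KS K) (g : Fin n → ℕ) :
    val K (innerProd K (ofPerm K α) x) (List.ofFn g) =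
      val K x (List.ofFn fun i => g (α.symm i)) := by
  classical
  induction x using KS_induction with
  | add x y hx hy => simp [hx, hy]
  | smul c x hx => simp [hx]
  | ofPerm m β =>
    by_cases h : m = n
    · subst h
      rw [innerProd_ofPerm_same, val_ofPerm, val_ofPerm, isPattern_ofFn, isPattern_ofFn]
      congr 1
      rw [eq_iff_iff]
      constructor
      · intro h i j; simpa using h (α.symm i) (α.symm j)
      · intro h i j; simpa using h (α i) (α j)
    · rw [innerProd_ofPerm_ne h, val_ofPerm_of_length_ne _ (by simpa using Ne.symm h)]
      simp

theorem val_innerProd_ofPerm_of_length_ne {n : ℕ} (α : Equiv.Perm (Fin n)) (x : KS K)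
    {w : List ℕ} (hw : w.length ≠ n) : val K (innerProd K (ofPerm K α) x) w = 0 := by
  induction x using KS_induction with
  | add x y hx hy => simp [hx, hy]
  | smul c x hx => simp [hx]
  | ofPerm m β =>
    by_cases h : m = n
    · subst h
      rw [innerProd_ofPerm_same, val_ofPerm_of_length_ne _ hw]
    · rw [innerProd_ofPerm_ne h]
      simp

variable (K) in
/-- The coefficients of an element of `KS ⊗ KS`, as a function of pairs of words. -/
def tensorVal : KS K ⊗[K] KS K →ₗ[K] (List ℕ → List ℕ → K) :=
  TensorProduct.lift (LinearMap.mk₂ K (fun x y u v => val K x u * val K y v)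
    (fun x x' y => by ext u v; simp [add_mul]) (fun c x y => by ext u v; simp [mul_assoc])
    (fun x y y' => by ext u v; simp [mul_add])
    (fun c x y => by ext u v; simp; ring))

theorem tensorVal_tmul (x y : KS K) (u v : List ℕ) :
    tensorVal K (x ⊗ₜ y) u v = val K x u * val K y v := rfl

theorem tensorVal_eq {p q : Σ n : ℕ, Equiv.Perm (Fin n)} {u v : List ℕ} (hp : IsPattern p u)
    (hq : IsPattern q v) (z : KS K ⊗[K] KS K) :
    tensorVal K z u v = finsuppTensorFinsupp' K _ _ z (p, q) := by
  induction z using TensorProduct.induction_on with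
  | zero => simp
  | tmul x y => rw [tensorVal_tmul, hp.val_eq, hq.val_eq, finsuppTensorFinsupp'_apply_apply]
  | add z z' hz hz' => simp [hz, hz']

open Classical in
theorem coprod_ofPerm {n : ℕ} (π : Equiv.Perm (Fin n)) :
    coprod K (ofPerm K π) = ∑ k ∈ Finset.range (n + 1),
      ∑ στ : Equiv.Perm (Fin k) × Equiv.Perm (Fin (n - k))
        with HasSubword π 0 στ.1 ∧ HasSubword π k στ.2,
        ofPerm K στ.1 ⊗ₜ[K] ofPerm K στ.2 := by
  simp [coprod, ofPerm]

/-- Inversion exchanges positions and letters; this lets the lemma on factors serve for the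
coproduct as well. -/
theorem hasSubword_iff {n k : ℕ} (π : Equiv.Perm (Fin n)) (s : ℕ) (σ : Equiv.Perm (Fin k)) :
    HasSubword π s σ ↔ HasFactor π.symm s σ.symm := Iff.rfl

open Classical in
theorem finsuppTensorFinsupp_ofPerm_tmul {n m : ℕ} (σ : Equiv.Perm (Fin n))
    (τ : Equiv.Perm (Fin m)) (p q : Σ n : ℕ, Equiv.Perm (Fin n)) :
    finsuppTensorFinsupp' K _ _ (ofPerm K σ ⊗ₜ[K] ofPerm K τ) (p, q) =
      if (⟨n, σ⟩ = p ∧ ⟨m, τ⟩ = q) then 1 else 0 := by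
  rw [finsuppTensorFinsupp'_apply_apply, ofPerm, ofPerm, Finsupp.single_apply,
    Finsupp.single_apply, ite_zero_mul_ite_zero, one_mul]

open Classical in
theorem coprod_ofPerm_apply {n k l : ℕ} (π : Equiv.Perm (Fin n)) (σ : Equiv.Perm (Fin k))
    (τ : Equiv.Perm (Fin l)) :
    finsuppTensorFinsupp' K _ _ (coprod K (ofPerm K π)) (⟨k, σ⟩, ⟨l, τ⟩) =
      if n = k + l ∧ HasSubword π 0 σ ∧ HasSubword π k τ then 1 else 0 := by
  rw [coprod_ofPerm, map_sum, Finsupp.finsetSum_apply]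
  simp only [map_sum, Finsupp.finsetSum_apply, finsuppTensorFinsupp_ofPerm_tmul]
  by_cases hn : n = k + l
  · rw [Finset.sum_eq_single k]
    -- The degree `n - k` occurs in the type of the second component, so it is replaced by a
    -- variable that can be identified with `l`.
    · have hm : ∀ m, m = l →
          (∑ x : Equiv.Perm (Fin k) × Equiv.Perm (Fin m)
            with HasSubword π 0 x.1 ∧ HasSubword π k x.2,
            if ((⟨k, x.1⟩ : Σ n : ℕ, Equiv.Perm (Fin n)) = ⟨k, σ⟩ ∧
              (⟨m, x.2⟩ : Σ n : ℕ, Equiv.Perm (Fin n)) = ⟨l, τ⟩) then (1 : K) else 0) =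
          if HasSubword π 0 σ ∧ HasSubword π k τ then 1 else 0 := by
        rintro m rfl
        rw [Finset.sum_filter]
        simp only [Sigma.mk.injEq, heq_eq_eq, true_and]
        rw [Finset.sum_eq_single (σ, τ)]
        · simp
        · rintro ⟨a, b⟩ - hab
          rw [if_neg (c := a = σ ∧ b = τ) fun h => hab (Prod.ext h.1 h.2)]
          simp
        · simp
      rw [hm _ (by omega)]
      simp [hn]
    · intro j _ hj
      refine Finset.sum_eq_zero fun x _ => if_neg ?_
      simp only [Sigma.mk.injEq]
      exact fun h => hj h.1.1
    · intro h
      simp at h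
      omega
  · rw [if_neg fun h => hn h.1]
    refine Finset.sum_eq_zero fun j hj => Finset.sum_eq_zero fun x _ => if_neg ?_
    simp only [Sigma.mk.injEq]
    simp only [Finset.mem_range] at hj
    rintro ⟨⟨h1, -⟩, h2, -⟩
    omega

/-- The coefficients of the coproduct of `x` are the values of `x` on shuffles. -/
theorem coprod_apply (x : KS K) {k l : ℕ} (σ : Equiv.Perm (Fin k)) (τ : Equiv.Perm (Fin l)) :
    finsuppTensorFinsupp' K _ _ (coprod K x) (⟨k, σ⟩, ⟨l, τ⟩) =
      shuffleSum (val K x) (shiftWord 0 ⟨k, σ⟩) (shiftWord k ⟨l, τ⟩) := by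
  classical
  -- With the increasing word and the inverses of `σ` and `τ`, the two rearranged factors are the
  -- word of `σ` and the shifted word of `τ`, and the conditions on factors turn into those on
  -- subwords.
  have h := sum_hasFactor_eq_shuffleSum (fun i : Fin (k + l) => (i : ℕ)) Fin.val_injective
    σ.symm τ.symm (val K x)
  simp only [Equiv.symm_symm, Fin.val_castAdd, Fin.val_natAdd] at h
  have e : shiftWord 0 ⟨k, σ⟩ = List.ofFn fun i => (σ i : ℕ) := by simp [shiftWord]
  rw [e, shiftWord, ← h]
  clear h
  have hv : ∀ (x : KS K) (π : Equiv.Perm (Fin (k + l))),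
      val K x (List.ofFn fun i => (π.symm i : ℕ)) = x ⟨k + l, π.symm⟩ := fun x π =>
    ((isPattern_ofFn _ _).2 fun i j => by simp).val_eq x
  simp only [hv]
  induction x using KS_induction with
  | add x y hx hy => simp [hx, hy, Finset.sum_add_distrib]
  | smul c x hx => simp [hx, Finset.mul_sum]
  | ofPerm n π =>
    rw [coprod_ofPerm_apply]
    by_cases hn : n = k + l
    · subst hn
      have : ∀ ρ : Equiv.Perm (Fin (k + l)), ofPerm K π ⟨k + l, ρ.symm⟩ =
          if ρ = π.symm then 1 else 0 := fun ρ => by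
        have : π = ρ.symm ↔ ρ = π.symm :=
          ⟨fun h => by rw [h, Equiv.symm_symm], fun h => by rw [h, Equiv.symm_symm]⟩
        simp [ofPerm, Finsupp.single_apply, this]
      simp [this, hasSubword_iff]
    · rw [if_neg fun h => hn h.1]
      refine (Finset.sum_eq_zero fun ρ _ => ?_).symm
      rw [ofPerm, Finsupp.single_apply, if_neg]
      intro h
      exact hn (congrArg Sigma.fst h)

end Values

/-! ### The outer algebra and the splitting formula for the inner product -/

section OuterAlgebra

/-- The vector space `KS`, as an algebra with respect to the outer product. -/
def OuterAlg (K : Type u) [Field K] : Type u := KS K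

variable {K : Type u} [Field K]

instance : AddCommGroup (OuterAlg K) := inferInstanceAs (AddCommGroup (KS K))

instance : Module K (OuterAlg K) := inferInstanceAs (Module K (KS K))

/-- The identity map from `KS` with its outer product to `KS`. -/
def toKS : OuterAlg K ≃ₗ[K] KS K := LinearEquiv.refl K (KS K)

theorem toKS_ext {x y : OuterAlg K}
    (h : ∀ w : List ℕ, w.Nodup → val K (toKS x) w = val K (toKS y) w) : x = y :=
  toKS.injective (val_ext h)

instance : Mul (OuterAlg K) := ⟨fun x y => toKS.symm (outerProd K (toKS x) (toKS y))⟩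

instance : One (OuterAlg K) := ⟨toKS.symm (outerOne K)⟩

theorem toKS_mul (x y : OuterAlg K) : toKS (x * y) = outerProd K (toKS x) (toKS y) := rfl

theorem toKS_one : toKS (1 : OuterAlg K) = outerOne K := rfl

theorem val_mul (x y : OuterAlg K) {w : List ℕ} (hw : w.Nodup) :
    val K (toKS (x * y)) w = conv (val K (toKS x)) (val K (toKS y)) w := by
  rw [toKS_mul, val_outerProd _ _ hw]

theorem val_one (w : List ℕ) : val K (toKS (1 : OuterAlg K)) w = if w = [] then 1 else 0 := by
  rw [toKS_one, val_outerOne]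

instance : Ring (OuterAlg K) where
  __ := instAddCommGroupOuterAlg
  mul := (· * ·)
  one := 1
  left_distrib x y z := toKS.injective (by simp [toKS_mul])
  right_distrib x y z := toKS.injective (by simp [toKS_mul])
  zero_mul x := toKS.injective (by simp [toKS_mul])
  mul_zero x := toKS.injective (by simp [toKS_mul])
  mul_assoc x y z := toKS_ext fun w hw => by
    rw [val_mul _ _ hw, val_mul _ _ hw,
      conv_congr hw (fun l hl => val_mul x y hl) (fun _ _ => rfl), conv_assoc,
      conv_congr hw (fun _ _ => rfl) (fun l hl => (val_mul y z hl).symm)]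
  one_mul x := toKS_ext fun w hw => by
    rw [val_mul _ _ hw]
    have := conv_eq_of_length (F := val K (toKS (1 : OuterAlg K))) (G := val K (toKS x)) (n := 0)
      (fun w h => by rw [val_one, if_neg (by rintro rfl; simp at h)]) [] w rfl
    simpa [val_one] using this
  mul_one x := toKS_ext fun w hw => by
    rw [val_mul _ _ hw, conv, Finset.sum_eq_single w.length]
    · simp [val_one]
    · intro i hi h
      rw [val_one, if_neg, mul_zero]
      simp at hi ⊢
      omega
    · simp

instance : Algebra K (OuterAlg K) :=
  Algebra.ofModule (fun c x y => toKS.injective (by simp [toKS_mul]))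
    (fun c x y => toKS.injective (by simp [toKS_mul]))

theorem OuterAlg_induction {motive : OuterAlg K → Prop} (x : OuterAlg K)
    (add : ∀ x y, motive x → motive y → motive (x + y))
    (smul : ∀ (c : K) x, motive x → motive (c • x))
    (ofPerm : ∀ (n : ℕ) (π : Equiv.Perm (Fin n)), motive (toKS.symm (ofPerm K π))) :
    motive x :=
  KS_induction (motive := fun x => motive (toKS.symm x)) (toKS x)
    (fun x y hx hy => by simpa using add _ _ hx hy) (fun c x hx => by simpa using smul c _ hx)
    ofPerm

variable (K) in
/-- The coproduct of `KS`. -/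
def outerComul : OuterAlg K →ₗ[K] OuterAlg K ⊗[K] OuterAlg K :=
  (TensorProduct.congr toKS toKS).symm.toLinearMap ∘ₗ coprod K ∘ₗ toKS.toLinearMap

variable (K) in
/-- The coefficients of a tensor, as a function of pairs of words. -/
def outerTensorVal : OuterAlg K ⊗[K] OuterAlg K →ₗ[K] (List ℕ → List ℕ → K) :=
  tensorVal K ∘ₗ (TensorProduct.congr toKS toKS).toLinearMap

variable (K) in
/-- The inner product of `KS`. -/
def inner : OuterAlg K →ₗ[K] OuterAlg K →ₗ[K] OuterAlg K :=
  ((innerProd K).compl₁₂ toKS.toLinearMap toKS.toLinearMap).compr₂ toKS.symm.toLinearMap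

theorem toKS_inner (x y : OuterAlg K) : toKS (inner K x y) = innerProd K (toKS x) (toKS y) := rfl

theorem outerTensorVal_tmul (x y : OuterAlg K) (u v : List ℕ) :
    outerTensorVal K (x ⊗ₜ y) u v = val K (toKS x) u * val K (toKS y) v := rfl

theorem outerTensorVal_mul (z z' : OuterAlg K ⊗[K] OuterAlg K) {u v : List ℕ} (hu : u.Nodup)
    (hv : v.Nodup) : outerTensorVal K (z * z') u v =
      ∑ i ∈ Finset.range (u.length + 1), ∑ j ∈ Finset.range (v.length + 1),
        outerTensorVal K z (u.take i) (v.take j) * outerTensorVal K z' (u.drop i) (v.drop j) := by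
  induction z using TensorProduct.induction_on with
  | zero => simp
  | add z₁ z₂ h₁ h₂ => simp [add_mul, h₁, h₂, Finset.sum_add_distrib]
  | tmul x y =>
    induction z' using TensorProduct.induction_on with
    | zero => simp
    | add z₁ z₂ h₁ h₂ => simp [mul_add, h₁, h₂, Finset.sum_add_distrib]
    | tmul x' y' =>
      rw [Algebra.TensorProduct.tmul_mul_tmul, outerTensorVal_tmul, val_mul _ _ hu,
        val_mul _ _ hv, conv, conv, Finset.sum_mul_sum]
      refine Finset.sum_congr rfl fun i _ => Finset.sum_congr rfl fun j _ => ?_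
      rw [outerTensorVal_tmul, outerTensorVal_tmul]
      ring

/-- The values of `x` on shuffles of two words without common letters are given by the
tensor `z`. -/
def IsSplit (x : OuterAlg K) (z : OuterAlg K ⊗[K] OuterAlg K) : Prop :=
  ∀ u v : List ℕ, (u ++ v).Nodup → shuffleSum (val K (toKS x)) u v = outerTensorVal K z u v

theorem IsSplit.add {x x' : OuterAlg K} {z z' : OuterAlg K ⊗[K] OuterAlg K} (h : IsSplit x z)
    (h' : IsSplit x' z') : IsSplit (x + x') (z + z') := fun u v huv => by
  simp only [map_add, Pi.add_apply, ← h u v huv, ← h' u v huv]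
  exact shuffleSum_add _ _ u v

theorem IsSplit.smul (c : K) {x : OuterAlg K} {z : OuterAlg K ⊗[K] OuterAlg K}
    (h : IsSplit x z) : IsSplit (c • x) (c • z) := fun u v huv => by
  simp only [map_smul, Pi.smul_apply, ← h u v huv]
  exact shuffleSum_mul_left c _ u v

/-- This is the compatibility of outer product and coproduct; it is `shuffleSum_conv` read on
values. -/
theorem IsSplit.mul {x x' : OuterAlg K} {z z' : OuterAlg K ⊗[K] OuterAlg K} (h : IsSplit x z)
    (h' : IsSplit x' z') : IsSplit (x * x') (z * z') := fun u v huv => by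
  rw [shuffleSum_congr fun l hl => val_mul x x' (hl.nodup_iff.2 huv), shuffleSum_conv,
    outerTensorVal_mul _ _ (huv.sublist (List.sublist_append_left _ _))
      (huv.sublist (List.sublist_append_right _ _))]
  refine Finset.sum_congr rfl fun i _ => Finset.sum_congr rfl fun j _ => ?_
  rw [h _ _ (huv.sublist ((List.take_sublist _ _).append (List.take_sublist _ _))),
    h' _ _ (huv.sublist ((List.drop_sublist _ _).append (List.drop_sublist _ _)))]

theorem isSplit_one : IsSplit (1 : OuterAlg K) 1 := fun u v _ => by
  rw [Algebra.TensorProduct.one_def, outerTensorVal_tmul, val_one, val_one]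
  rw [shuffleSum_congr (G := fun _ => if u = [] ∧ v = [] then (1 : K) else 0)]
  · rcases u with _ | ⟨a, u⟩
    · simp [shuffleSum_nil_left]
    · simp [shuffleSum]
  · intro l hl
    rw [val_one]
    congr 1
    rw [← List.append_eq_nil_iff, eq_iff_iff]
    exact ⟨fun e => (e ▸ hl).symm.eq_nil, fun e => (e ▸ hl).eq_nil⟩

theorem nodup_shiftWord_append {k l : ℕ} (σ : Equiv.Perm (Fin k)) (τ : Equiv.Perm (Fin l)) :
    (shiftWord 0 ⟨k, σ⟩ ++ shiftWord k ⟨l, τ⟩).Nodup := by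
  refine (nodup_shiftWord _ _).append (nodup_shiftWord _ _) ?_
  intro a ha hb
  simp only [shiftWord, List.mem_ofFn] at ha hb
  obtain ⟨i, hi⟩ := ha
  obtain ⟨j, hj⟩ := hb
  have := (σ i).2
  omega

/-- The coproduct only sees pairs of words with all letters of the first below those of the second,
and these already determine the tensor. `IsSplit` asks for more, namely independence of how the
letters interleave; this fails for the permutation `132`, for instance. -/
theorem IsSplit.outerComul_eq {x : OuterAlg K} {z : OuterAlg K ⊗[K] OuterAlg K}
    (h : IsSplit x z) : outerComul K x = z := by
  apply (TensorProduct.congr toKS toKS).injective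
  apply (finsuppTensorFinsupp' K _ _).injective
  ext ⟨⟨k, σ⟩, ⟨l, τ⟩⟩
  rw [← tensorVal_eq (isPattern_shiftWord 0 _) (isPattern_shiftWord k _)
    (TensorProduct.congr toKS toKS z)]
  have := h _ _ (nodup_shiftWord_append σ τ)
  rw [← coprod_apply] at this
  have e : TensorProduct.congr toKS toKS (outerComul K x) = coprod K (toKS x) := by
    simp [outerComul]
  rw [e]
  exact this

theorem val_innerProd_outerProd_ofPerm {n m : ℕ} (α : Equiv.Perm (Fin n))
    (β : Equiv.Perm (Fin m)) (x : KS K) {g : Fin (n + m) → ℕ} (hg : Function.Injective g) :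
    val K (innerProd K (outerProd K (ofPerm K α) (ofPerm K β)) x) (List.ofFn g) =
      shuffleSum (val K x) (List.ofFn fun i => g (Fin.castAdd m (α.symm i)))
        (List.ofFn fun i => g (Fin.natAdd n (β.symm i))) := by
  rw [outerProd_ofPerm, ← sum_hasFactor_eq_shuffleSum g hg]
  simp [val_innerProd_ofPerm]

/-- Left multiplication with `α ⋆ β` evaluates `x` on the shuffles of two rearranged factors of a
word, and the tensor separates these factors. Their letters interleave arbitrarily, which is why
`IsSplit` allows all pairs of words. -/
theorem IsSplit.inner_mul {x : OuterAlg K} {z : OuterAlg K ⊗[K] OuterAlg K}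
    (h : IsSplit x z) (y y' : OuterAlg K) :
    inner K (y * y') x =
      LinearMap.mul' K (OuterAlg K) (TensorProduct.map (inner K y) (inner K y') z) := by
  induction y using OuterAlg_induction with
  | add a b ha hb => simp [add_mul, ha, hb, TensorProduct.map_add_left]
  | smul c a ha => simp [ha, TensorProduct.map_smul_left]
  | ofPerm n α =>
    induction y' using OuterAlg_induction with
    | add a b ha hb => simp [mul_add, ha, hb, TensorProduct.map_add_right]
    | smul c a ha => simp [ha, TensorProduct.map_smul_right]
    | ofPerm m β =>
      refine toKS_ext fun w hw => ?_
      have hα := fun (y : OuterAlg K) (w : List ℕ) (h : w.length ≠ n) =>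
        val_innerProd_ofPerm_of_length_ne (K := K) α (toKS y) h
      have hβ := fun (y : OuterAlg K) (w : List ℕ) (h : w.length ≠ m) =>
        val_innerProd_ofPerm_of_length_ne (K := K) β (toKS y) h
      by_cases hl : w.length = n + m
      · obtain ⟨g, hg, rfl⟩ := exists_ofFn_of_nodup hw hl
        rw [toKS_inner, toKS_mul, LinearEquiv.apply_symm_apply, LinearEquiv.apply_symm_apply,
          val_innerProd_outerProd_ofPerm α β _ hg, h]
        · clear h
          induction z using TensorProduct.induction_on with
          | zero => simp
          | add z z' h h' => simp [h, h']
          | tmul y y' =>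
            rw [TensorProduct.map_tmul, LinearMap.mul'_apply, outerTensorVal_tmul,
              val_mul _ _ hw, ofFn_append_split g, toKS_inner, toKS_inner,
              LinearEquiv.apply_symm_apply, LinearEquiv.apply_symm_apply,
              conv_eq_of_length (hα y) _ _ (by simp), val_innerProd_ofPerm, val_innerProd_ofPerm]
        · have : List.Perm (List.ofFn (fun i => g (Fin.castAdd m (α.symm i))) ++
              List.ofFn fun i => g (Fin.natAdd n (β.symm i))) (List.ofFn g) := by
            rw [ofFn_append_split g]
            exact (Equiv.Perm.ofFn_comp_perm α.symm fun i => g (Fin.castAdd m i)).append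
              (Equiv.Perm.ofFn_comp_perm β.symm fun i => g (Fin.natAdd n i))
          exact this.nodup_iff.2 hw
      · rw [toKS_inner, toKS_mul, LinearEquiv.apply_symm_apply, LinearEquiv.apply_symm_apply,
          outerProd_ofPerm]
        have : ∀ z : OuterAlg K ⊗[K] OuterAlg K, val K (toKS (LinearMap.mul' K (OuterAlg K)
            (TensorProduct.map (inner K (toKS.symm (ofPerm K α)))
              (inner K (toKS.symm (ofPerm K β))) z))) w = 0 := by
          intro z
          induction z using TensorProduct.induction_on with
          | zero => simp
          | add z z' h h' => simp [h, h']
          | tmul y y' =>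
            rw [TensorProduct.map_tmul, LinearMap.mul'_apply, val_mul _ _ hw]
            exact conv_eq_zero_of_length (hα y) (hβ y') hl
        rw [this]
        simp only [map_sum, LinearMap.sum_apply, Finset.sum_apply]
        exact Finset.sum_eq_zero fun π _ => val_innerProd_ofPerm_of_length_ne π _ hl

end OuterAlgebra

/-! ### Homogeneous components -/

section Degree

variable (K : Type u) [Field K]

/-- The group algebra `K S_n`, as a subspace of `KS`. -/
def degreePart (n : ℕ) : Submodule K (KS K) :=
  Finsupp.supported K K {p : Σ n : ℕ, Equiv.Perm (Fin n) | p.1 = n}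

variable {K}

theorem ofPerm_mem_degreePart {n : ℕ} (π : Equiv.Perm (Fin n)) : ofPerm K π ∈ degreePart K n :=
  Finsupp.single_mem_supported K 1 rfl

theorem degreePart_eq_span (n : ℕ) :
    degreePart K n = Submodule.span K (Set.range fun π : Equiv.Perm (Fin n) => ofPerm K π) := by
  rw [degreePart, Finsupp.supported_eq_span_single]
  congr 1
  ext x
  constructor
  · rintro ⟨⟨m, π⟩, rfl, rfl⟩
    exact ⟨π, rfl⟩
  · rintro ⟨π, rfl⟩
    exact ⟨⟨n, π⟩, rfl, rfl⟩

theorem val_eq_zero_of_mem_degreePart {n : ℕ} {x : KS K} (hx : x ∈ degreePart K n) {w : List ℕ}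
    (hw : w.length ≠ n) : val K x w = 0 := by
  rw [degreePart_eq_span] at hx
  induction hx using Submodule.span_induction with
  | mem x h =>
    obtain ⟨π, rfl⟩ := h
    exact val_ofPerm_of_length_ne π hw
  | zero => simp
  | add x y _ _ hx hy => simp [hx, hy]
  | smul c x _ hx => simp [hx]

theorem outerProd_mem_degreePart {n m : ℕ} {x y : KS K} (hx : x ∈ degreePart K n)
    (hy : y ∈ degreePart K m) : outerProd K x y ∈ degreePart K (n + m) := by
  rw [degreePart_eq_span] at hx hy
  induction hx, hy using Submodule.span_induction₂ with
  | mem_mem x y hx hy =>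
    obtain ⟨α, rfl⟩ := hx
    obtain ⟨β, rfl⟩ := hy
    rw [outerProd_ofPerm]
    exact Submodule.sum_mem _ fun π _ => ofPerm_mem_degreePart π
  | zero_left y _ => simp
  | zero_right x _ => simp
  | add_left x y z _ _ _ hx hy => rw [map_add, LinearMap.add_apply]; exact add_mem hx hy
  | add_right x y z _ _ _ hx hy => rw [map_add]; exact add_mem hx hy
  | smul_left c x y _ _ h => rw [map_smul, LinearMap.smul_apply]; exact Submodule.smul_mem _ c h
  | smul_right c x y _ _ h => rw [map_smul]; exact Submodule.smul_mem _ c h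

theorem outerOne_mem_degreePart : outerOne K ∈ degreePart K 0 := ofPerm_mem_degreePart _

theorem iSupIndep_degreePart : iSupIndep (degreePart K) := by
  intro n
  have h : (⨆ (j : ℕ) (_ : j ≠ n), degreePart K j) ≤
      Finsupp.supported K K {p : Σ n : ℕ, Equiv.Perm (Fin n) | p.1 ≠ n} :=
    iSup₂_le fun j hj => Finsupp.supported_mono fun p (hp : p.1 = j) => by
      rw [Set.mem_ofPred_eq, hp]; exact hj
  refine Disjoint.mono_right h (Finsupp.disjoint_supported_supported ?_)
  exact Set.disjoint_left.2 fun p hp hp' => hp' hp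

theorem counitMap_eq_val (x : KS K) : counitMap K x = val K x [] := by
  classical
  induction x using KS_induction with
  | add x y hx hy => simp [hx, hy]
  | smul c x hx => simp [hx]
  | ofPerm n π =>
    have : IsPattern ⟨n, π⟩ [] ↔ n = 0 := by
      constructor
      · exact fun h => h.length_eq.symm
      · rintro rfl
        exact ⟨Fin.elim0, rfl, fun i => i.elim0⟩
    rw [val_ofPerm]
    simp [counitMap, ofPerm, this]

theorem innerProd_ofPerm_of_mem_degreePart_ne {n m : ℕ} (h : m ≠ n) (α : Equiv.Perm (Fin n))
    {x : KS K} (hx : x ∈ degreePart K m) : innerProd K (ofPerm K α) x = 0 := by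
  rw [degreePart_eq_span] at hx
  induction hx using Submodule.span_induction with
  | mem x hx =>
    obtain ⟨π, rfl⟩ := hx
    exact innerProd_ofPerm_ne h α π
  | zero => simp
  | add x y _ _ hx hy => simp [hx, hy]
  | smul c x _ hx => simp [hx]

theorem innerProd_ofPerm_one {n : ℕ} {x : KS K} (hx : x ∈ degreePart K n) :
    innerProd K (ofPerm K (1 : Equiv.Perm (Fin n))) x = x := by
  rw [degreePart_eq_span] at hx
  induction hx using Submodule.span_induction with
  | mem x hx =>
    obtain ⟨π, rfl⟩ := hx
    rw [innerProd_ofPerm_same, mul_one]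
  | zero => simp
  | add x y _ _ hx hy => simp [hx, hy]
  | smul c x _ hx => simp [hx]

theorem rightMul_ofPerm (s : ℕ → KS K) {n : ℕ} (α : Equiv.Perm (Fin n)) :
    rightMul K s (ofPerm K α) = innerProd K (ofPerm K α) (s n) := by
  simp [rightMul, ofPerm]

theorem rightMul_of_mem_degreePart (s : ℕ → KS K) {n : ℕ} {x : KS K} (hx : x ∈ degreePart K n) :
    rightMul K s x = innerProd K x (s n) := by
  rw [degreePart_eq_span] at hx
  induction hx using Submodule.span_induction with
  | mem x hx =>
    obtain ⟨π, rfl⟩ := hx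
    exact rightMul_ofPerm s π
  | zero => simp
  | add x y _ _ hx hy => simp [hx, hy]
  | smul c x _ hx => simp [hx]

theorem innerProd_mem_degreePart {n : ℕ} {x y : KS K} (hx : x ∈ degreePart K n) :
    innerProd K x y ∈ degreePart K n := by
  rw [degreePart_eq_span] at hx
  induction hx using Submodule.span_induction with
  | mem x hx =>
    obtain ⟨α, rfl⟩ := hx
    induction y using KS_induction with
    | add x y hx hy => rw [map_add]; exact add_mem hx hy
    | smul c x hx => rw [map_smul]; exact Submodule.smul_mem _ c hx
    | ofPerm m β =>
      by_cases h : m = n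
      · subst h
        rw [innerProd_ofPerm_same]
        exact ofPerm_mem_degreePart _
      · rw [innerProd_ofPerm_ne h]
        exact zero_mem _
  | zero => simp
  | add x y _ _ hx hy => rw [map_add, LinearMap.add_apply]; exact add_mem hx hy
  | smul c x _ hx => rw [map_smul, LinearMap.smul_apply]; exact Submodule.smul_mem _ c hx

theorem innerProd_assoc (x y z : KS K) :
    innerProd K (innerProd K x y) z = innerProd K x (innerProd K y z) := by
  induction x using KS_induction with
  | add a b ha hb => simp [ha, hb]
  | smul c a ha => simp [ha]
  | ofPerm n α =>
    induction y using KS_induction with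
    | add a b ha hb => simp [ha, hb]
    | smul c a ha => simp [ha]
    | ofPerm m β =>
      by_cases h : m = n
      · subst h
        induction z using KS_induction with
        | add a b ha hb => simp [ha, hb]
        | smul c a ha => simp [ha]
        | ofPerm k γ =>
          by_cases h : k = m
          · subst h
            simp only [innerProd_ofPerm_same, mul_assoc]
          · rw [innerProd_ofPerm_same, innerProd_ofPerm_ne h, innerProd_ofPerm_ne h, map_zero]
      · rw [innerProd_ofPerm_ne h, map_zero, LinearMap.zero_apply,
          innerProd_ofPerm_of_mem_degreePart_ne h α
            (innerProd_mem_degreePart (ofPerm_mem_degreePart β))]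

end Degree

/-! ### Group-like series, the bialgebras they generate, and right multiplication -/

section Grouplike

variable {K : Type u} [Field K]

/-- A family of homogeneous elements of `KS` whose formal sum is group-like. -/
structure IsGrouplike (t : ℕ → OuterAlg K) : Prop where
  zero : t 0 = 1
  mem_degreePart : ∀ n, toKS (t n) ∈ degreePart K n
  char : IsShuffleChar fun w => val K (toKS (t w.length)) w

variable {t s : ℕ → OuterAlg K}

/-- By homogeneity only the summand with degrees `u.length` and `v.length` survives, and for it the
claim is multiplicativity on shuffles. -/
theorem IsGrouplike.isSplit (ht : IsGrouplike t) (n : ℕ) :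
    IsSplit (t n) (∑ p ∈ Finset.HasAntidiagonal.antidiagonal n, t p.1 ⊗ₜ[K] t p.2) := by
  intro u v huv
  simp only [map_sum, Finset.sum_apply, outerTensorVal_tmul]
  by_cases h : u.length + v.length = n
  · rw [Finset.sum_eq_single (u.length, v.length)]
    · rw [← ht.char u v huv]
      refine shuffleSum_congr fun l hl => ?_
      rw [hl.length_eq, List.length_append, h]
    · intro p _ hp
      by_cases h1 : u.length = p.1
      · have h2 : v.length ≠ p.2 := fun h2 => hp (Prod.ext h1.symm h2.symm)
        rw [val_eq_zero_of_mem_degreePart (ht.mem_degreePart p.2) h2, mul_zero]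
      · rw [val_eq_zero_of_mem_degreePart (ht.mem_degreePart p.1) h1, zero_mul]
    · simp [h]
  · rw [shuffleSum_congr (G := fun _ => 0), Finset.sum_eq_zero]
    · simp [shuffleSum]
    · intro p hp
      rw [Finset.HasAntidiagonal.mem_antidiagonal] at hp
      by_cases h1 : u.length = p.1
      · have h2 : v.length ≠ p.2 := by omega
        rw [val_eq_zero_of_mem_degreePart (ht.mem_degreePart p.2) h2, mul_zero]
      · rw [val_eq_zero_of_mem_degreePart (ht.mem_degreePart p.1) h1, zero_mul]
    · intro l hl
      rw [val_eq_zero_of_mem_degreePart (ht.mem_degreePart n)]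
      rw [hl.length_eq, List.length_append]
      exact h

theorem IsGrouplike.outerComul_eq (ht : IsGrouplike t) (n : ℕ) :
    outerComul K (t n) = ∑ p ∈ Finset.HasAntidiagonal.antidiagonal n, t p.1 ⊗ₜ[K] t p.2 :=
  (ht.isSplit n).outerComul_eq

variable (K) in
/-- The elements of `KS` on whose products the coproduct is multiplicative. -/
def splitSubalgebra : Subalgebra K (OuterAlg K) where
  carrier := {x | IsSplit x (outerComul K x)}
  mul_mem' {x y} hx hy := by
    have := IsSplit.mul hx hy
    rwa [← this.outerComul_eq] at this
  add_mem' {x y} hx hy := by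
    have := IsSplit.add hx hy
    rwa [← this.outerComul_eq] at this
  algebraMap_mem' c := by
    have := IsSplit.smul c (isSplit_one (K := K))
    rw [← this.outerComul_eq] at this
    rwa [Algebra.algebraMap_eq_smul_one]

variable (K) in
/-- The restriction of the coproduct to `splitSubalgebra`. -/
def splitComul : splitSubalgebra K →ₐ[K] OuterAlg K ⊗[K] OuterAlg K :=
  AlgHom.ofLinearMap (outerComul K ∘ₗ (splitSubalgebra K).val.toLinearMap)
    isSplit_one.outerComul_eq fun x y => (IsSplit.mul x.2 y.2).outerComul_eq

theorem splitComul_apply (x : splitSubalgebra K) : splitComul K x = outerComul K x := rfl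

/-- The subalgebra generated by the elements `t n`. -/
abbrev genSubalgebra (t : ℕ → OuterAlg K) : Subalgebra K (OuterAlg K) :=
  Algebra.adjoin K (Set.range t)

/-- The generators of `genSubalgebra t`. -/
def gen (t : ℕ → OuterAlg K) (n : ℕ) : genSubalgebra t := ⟨t n, Algebra.subset_adjoin ⟨n, rfl⟩⟩

theorem coe_gen (t : ℕ → OuterAlg K) (n : ℕ) : (gen t n : OuterAlg K) = t n := rfl

theorem genSubalgebra_hom_ext {B : Type*} [Semiring B] [Algebra K B]
    {f g : genSubalgebra t →ₐ[K] B} (h : ∀ n, f (gen t n) = g (gen t n)) : f = g :=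
  AlgHom.adjoin_ext (by rintro _ ⟨n, rfl⟩; exact h n)

theorem IsGrouplike.genSubalgebra_le (ht : IsGrouplike t) :
    genSubalgebra t ≤ splitSubalgebra K := by
  refine Algebra.adjoin_le ?_
  rintro _ ⟨n, rfl⟩
  have := ht.isSplit n
  rwa [← ht.outerComul_eq] at this

/-- The inclusion of `genSubalgebra t ⊗ genSubalgebra t`. -/
def genTensorVal (t : ℕ → OuterAlg K) :
    genSubalgebra t ⊗[K] genSubalgebra t →ₐ[K] OuterAlg K ⊗[K] OuterAlg K :=
  Algebra.TensorProduct.map (genSubalgebra t).val (genSubalgebra t).val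

/-- Modules over a field are flat. Injectivity allows the coproduct to be pulled back to the tensor
square of the subalgebra. -/
theorem genTensorVal_injective (t : ℕ → OuterAlg K) : Function.Injective (genTensorVal t) :=
  TensorProduct.map_injective_of_flat_flat (genSubalgebra t).val.toLinearMap
    (genSubalgebra t).val.toLinearMap Subtype.val_injective Subtype.val_injective

theorem IsGrouplike.outerComul_mem_range (ht : IsGrouplike t) (x : genSubalgebra t) :
    splitComul K (Subalgebra.inclusion ht.genSubalgebra_le x) ∈ (genTensorVal t).range := by
  -- The coproduct is known to be multiplicative on `splitSubalgebra K` only. The elements with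
  -- coproduct in the range form a subalgebra there, and it suffices that this contains the
  -- generators.
  have h : genSubalgebra t ≤ ((genTensorVal t).range.comap (splitComul K)).map
      (splitSubalgebra K).val := by
    refine Algebra.adjoin_le ?_
    rintro _ ⟨n, rfl⟩
    refine ⟨⟨t n, ht.genSubalgebra_le (gen t n).2⟩, ?_, rfl⟩
    change splitComul K _ ∈ (genTensorVal t).range
    rw [splitComul_apply, ht.outerComul_eq]
    exact sum_mem fun p _ => ⟨gen t p.1 ⊗ₜ gen t p.2, rfl⟩
  obtain ⟨y, hy, hxy⟩ := h x.2
  have : Subalgebra.inclusion ht.genSubalgebra_le x = y := Subtype.ext hxy.symm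
  rw [this]
  exact hy

/-- The coproduct of `genSubalgebra t`. -/
def IsGrouplike.comul (ht : IsGrouplike t) :
    genSubalgebra t →ₐ[K] genSubalgebra t ⊗[K] genSubalgebra t :=
  (AlgEquiv.ofInjective (genTensorVal t) (genTensorVal_injective t)).symm.toAlgHom.comp
    (((splitComul K).comp (Subalgebra.inclusion ht.genSubalgebra_le)).codRestrict _
      ht.outerComul_mem_range)

theorem IsGrouplike.genTensorVal_comul (ht : IsGrouplike t) (x : genSubalgebra t) :
    genTensorVal t (ht.comul x) = outerComul K (x : OuterAlg K) :=
  congrArg Subtype.val ((AlgEquiv.ofInjective (genTensorVal t)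
    (genTensorVal_injective t)).apply_symm_apply _)

theorem IsGrouplike.comul_gen (ht : IsGrouplike t) (n : ℕ) :
    ht.comul (gen t n) = ∑ p ∈ Finset.HasAntidiagonal.antidiagonal n, gen t p.1 ⊗ₜ[K] gen t p.2 := by
  apply genTensorVal_injective t
  rw [ht.genTensorVal_comul, coe_gen, ht.outerComul_eq, map_sum]
  rfl

variable (K) in
/-- The counit of `KS`. -/
def outerCounit : OuterAlg K →ₐ[K] K :=
  AlgHom.ofLinearMap (counitMap K ∘ₗ toKS.toLinearMap)
    (by simp [counitMap_eq_val, val_one])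
    (fun x y => by simp [counitMap_eq_val, val_mul _ _ List.nodup_nil, conv_nil])

theorem outerCounit_apply (x : OuterAlg K) : outerCounit K x = counitMap K (toKS x) := rfl

theorem IsGrouplike.outerCounit_eq (ht : IsGrouplike t) (n : ℕ) :
    outerCounit K (t n) = if n = 0 then 1 else 0 := by
  rw [outerCounit_apply, counitMap_eq_val]
  split_ifs with h
  · rw [h, ht.zero, val_one, if_pos rfl]
  · exact val_eq_zero_of_mem_degreePart (ht.mem_degreePart n) (by simpa using Ne.symm h)

theorem sum_antidiagonal_assoc {M : Type*} [AddCommMonoid M] (f : ℕ → ℕ → ℕ → M) (n : ℕ) :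
    ∑ p ∈ Finset.HasAntidiagonal.antidiagonal n, ∑ q ∈ Finset.HasAntidiagonal.antidiagonal p.1, f q.1 q.2 p.2 =
      ∑ p ∈ Finset.HasAntidiagonal.antidiagonal n, ∑ q ∈ Finset.HasAntidiagonal.antidiagonal p.2, f p.1 q.1 q.2 := by
  rw [Finset.sum_sigma', Finset.sum_sigma']
  refine Finset.sum_nbij' (fun x => ⟨(x.2.1, x.2.2 + x.1.2), (x.2.2, x.1.2)⟩)
    (fun x => ⟨(x.1.1 + x.2.1, x.2.2), (x.1.1, x.2.1)⟩) ?_ ?_ ?_ ?_ ?_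
  · rintro ⟨⟨i, j⟩, k, l⟩ h
    simp at h ⊢
    omega
  · rintro ⟨⟨i, j⟩, k, l⟩ h
    simp at h ⊢
    omega
  · rintro ⟨⟨i, j⟩, k, l⟩ h
    simp at h
    obtain ⟨h1, rfl⟩ := h
    rfl
  · rintro ⟨⟨i, j⟩, k, l⟩ h
    simp at h
    obtain ⟨h1, rfl⟩ := h
    rfl
  · rintro ⟨⟨i, j⟩, k, l⟩ _
    rfl

/-- The bialgebra generated by a group-like family. -/
abbrev IsGrouplike.bialgebra (ht : IsGrouplike t) : Bialgebra K (genSubalgebra t) :=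
  Bialgebra.ofAlgHom ht.comul ((outerCounit K).comp (genSubalgebra t).val)
    -- Coassociativity and the counit laws are equalities of algebra homomorphisms, so they reduce
    -- to the formula for the coproduct of a generator.
    (genSubalgebra_hom_ext fun n => by
      have h := sum_antidiagonal_assoc (fun i j k => gen t i ⊗ₜ[K] (gen t j ⊗ₜ[K] gen t k)) n
      simpa [ht.comul_gen, TensorProduct.sum_tmul, TensorProduct.tmul_sum] using h)
    (genSubalgebra_hom_ext fun n => by
      simp only [AlgHom.comp_apply, ht.comul_gen, map_sum, Algebra.TensorProduct.map_tmul,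
        Subalgebra.coe_val, coe_gen, ht.outerCounit_eq]
      rw [Finset.sum_eq_single (0, n)]
      · simp
      · rintro ⟨i, j⟩ hp h
        have : i ≠ 0 := by
          rintro rfl
          simp at hp h
          exact h hp
        simp [this]
      · simp)
    (genSubalgebra_hom_ext fun n => by
      simp only [AlgHom.comp_apply, ht.comul_gen, map_sum, Algebra.TensorProduct.map_tmul,
        Subalgebra.coe_val, coe_gen, ht.outerCounit_eq]
      rw [Finset.sum_eq_single (n, 0)]
      · simp
      · rintro ⟨i, j⟩ hp h
        have : j ≠ 0 := by
          rintro rfl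
          simp at hp h
          exact h hp
        simp [this]
      · simp)

/-- The span of all products of the elements `t i` of total degree `n`. -/
def wordSpan (t : ℕ → OuterAlg K) (n : ℕ) : Submodule K (KS K) :=
  Submodule.span K {x | ∃ l : List ℕ, l.sum = n ∧ toKS (l.map t).prod = x}

theorem prod_mem_wordSpan (t : ℕ → OuterAlg K) (l : List ℕ) :
    toKS (l.map t).prod ∈ wordSpan t l.sum :=
  Submodule.subset_span ⟨l, rfl, rfl⟩

theorem IsGrouplike.prod_mem_degreePart (ht : IsGrouplike t) (l : List ℕ) :
    toKS (l.map t).prod ∈ degreePart K l.sum := by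
  induction l with
  | nil => exact outerOne_mem_degreePart
  | cons a l ih =>
    rw [List.map_cons, List.prod_cons, toKS_mul, List.sum_cons]
    exact outerProd_mem_degreePart (ht.mem_degreePart a) ih

theorem IsGrouplike.wordSpan_le (ht : IsGrouplike t) (n : ℕ) : wordSpan t n ≤ degreePart K n := by
  refine Submodule.span_le.2 ?_
  rintro _ ⟨l, rfl, rfl⟩
  exact ht.prod_mem_degreePart l

theorem outerProd_mem_wordSpan {n m : ℕ} {x y : KS K} (hx : x ∈ wordSpan t n)
    (hy : y ∈ wordSpan t m) : outerProd K x y ∈ wordSpan t (n + m) := by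
  rw [wordSpan] at hx hy
  induction hx, hy using Submodule.span_induction₂ with
  | mem_mem x y hx hy =>
    obtain ⟨l, rfl, rfl⟩ := hx
    obtain ⟨l', rfl, rfl⟩ := hy
    rw [← toKS_mul, ← List.prod_append, ← List.map_append, ← List.sum_append]
    exact prod_mem_wordSpan t _
  | zero_left y _ => simp
  | zero_right x _ => simp
  | add_left x y z _ _ _ hx hy => rw [map_add, LinearMap.add_apply]; exact add_mem hx hy
  | add_right x y z _ _ _ hx hy => rw [map_add]; exact add_mem hx hy
  | smul_left c x y _ _ h => rw [map_smul, LinearMap.smul_apply]; exact Submodule.smul_mem _ c h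
  | smul_right c x y _ _ h => rw [map_smul]; exact Submodule.smul_mem _ c h

theorem toKS_mem_iSup_wordSpan_iff (x : OuterAlg K) :
    toKS x ∈ ⨆ n, wordSpan t n ↔ x ∈ genSubalgebra t := by
  have h1 : (⨆ n, wordSpan t n) ≤
      (Subalgebra.toSubmodule (genSubalgebra t)).map toKS.toLinearMap := by
    refine iSup_le fun n => Submodule.span_le.2 ?_
    rintro _ ⟨l, rfl, rfl⟩
    refine ⟨_, ?_, rfl⟩
    change (l.map t).prod ∈ genSubalgebra t
    refine list_prod_mem fun x hx => ?_
    obtain ⟨a, -, rfl⟩ := List.mem_map.1 hx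
    exact (gen t a).2
  have h2 : Subalgebra.toSubmodule (genSubalgebra t) ≤
      (⨆ n, wordSpan t n).comap toKS.toLinearMap := by
    rw [Algebra.adjoin_eq_span, Submodule.span_le]
    intro x hx
    obtain ⟨l, hl, rfl⟩ := Submonoid.exists_list_of_mem_closure hx
    obtain ⟨l, rfl⟩ : ∃ l' : List ℕ, l'.map t = l := by
      have : l ∈ Set.range (List.map t) := by
        rw [Set.range_list_map]
        exact hl
      exact this
    exact Submodule.mem_iSup_of_mem l.sum (prod_mem_wordSpan t l)
  constructor
  · intro h
    obtain ⟨y, hy, e⟩ := h1 h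
    rwa [toKS.injective e] at hy
  · exact fun h => h2 h

/-- The homogeneous tensors of degree `n` over `genSubalgebra t`. -/
def tensorWordSpan (t : ℕ → OuterAlg K) (n : ℕ) : Submodule K (OuterAlg K ⊗[K] OuterAlg K) :=
  Submodule.span K {z | ∃ l l' : List ℕ, l.sum + l'.sum = n ∧
    (l.map t).prod ⊗ₜ[K] (l'.map t).prod = z}

theorem IsGrouplike.outerComul_prod_mem (ht : IsGrouplike t) (l : List ℕ) :
    outerComul K (l.map t).prod ∈ tensorWordSpan t l.sum := by
  induction l with
  | nil =>
    rw [List.map_nil, List.prod_nil, isSplit_one.outerComul_eq]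
    exact Submodule.subset_span ⟨[], [], rfl, rfl⟩
  | cons a l ih =>
    have hm : ∀ l : List ℕ, (l.map t).prod ∈ genSubalgebra t := fun l =>
      list_prod_mem fun x hx => by
        obtain ⟨a, -, rfl⟩ := List.mem_map.1 hx
        exact (gen t a).2
    have := IsSplit.mul (ht.isSplit a) (ht.genSubalgebra_le (hm l))
    rw [List.map_cons, List.prod_cons, this.outerComul_eq, List.sum_cons]
    generalize outerComul K (l.map t).prod = z at ih
    clear this
    rw [tensorWordSpan] at ih
    induction ih using Submodule.span_induction with
    | mem z hz =>
      obtain ⟨l₁, l₂, h, rfl⟩ := hz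
      rw [Finset.sum_mul]
      refine Submodule.sum_mem _ fun p hp => Submodule.subset_span ⟨p.1 :: l₁, p.2 :: l₂, ?_, ?_⟩
      · rw [Finset.HasAntidiagonal.mem_antidiagonal] at hp
        simp only [List.sum_cons]
        omega
      · rw [Algebra.TensorProduct.tmul_mul_tmul]
        simp
    | zero => simp
    | add x y _ _ hx hy => rw [mul_add]; exact add_mem hx hy
    | smul c x _ hx => rw [mul_smul_comm]; exact Submodule.smul_mem _ c hx

theorem map_tensorWordSpan_le (n : ℕ) :
    (tensorWordSpan t n).map (TensorProduct.congr toKS toKS).toLinearMap ≤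
      ⨆ p ∈ Finset.HasAntidiagonal.antidiagonal n,
        LinearMap.range (TensorProduct.mapIncl (wordSpan t p.1) (wordSpan t p.2)) := by
  rw [tensorWordSpan, Submodule.map_span, Submodule.span_le]
  rintro _ ⟨_, ⟨l, l', h, rfl⟩, rfl⟩
  refine Submodule.mem_iSup_of_mem (l.sum, l'.sum)
    (Submodule.mem_iSup_of_mem (Finset.HasAntidiagonal.mem_antidiagonal.2 h) ?_)
  exact ⟨⟨_, prod_mem_wordSpan t l⟩ ⊗ₜ ⟨_, prod_mem_wordSpan t l'⟩, rfl⟩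

theorem IsGrouplike.coprod_mem (ht : IsGrouplike t) {n : ℕ} {x : KS K} (hx : x ∈ wordSpan t n) :
    coprod K x ∈ ⨆ p ∈ Finset.HasAntidiagonal.antidiagonal n,
      LinearMap.range (TensorProduct.mapIncl (wordSpan t p.1) (wordSpan t p.2)) := by
  rw [wordSpan] at hx
  induction hx using Submodule.span_induction with
  | mem x hx =>
    obtain ⟨l, rfl, rfl⟩ := hx
    refine map_tensorWordSpan_le l.sum ⟨_, ht.outerComul_prod_mem l, ?_⟩
    exact LinearEquiv.apply_symm_apply (TensorProduct.congr toKS toKS) _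
  | zero => simp
  | add x y _ _ hx hy => rw [map_add]; exact add_mem hx hy
  | smul c x _ hx => rw [map_smul]; exact Submodule.smul_mem _ c hx

/-- The inclusion of `genSubalgebra t` in `KS`. -/
def genIncl (t : ℕ → OuterAlg K) : genSubalgebra t →ₗ[K] KS K :=
  toKS.toLinearMap ∘ₗ (genSubalgebra t).val.toLinearMap

theorem genIncl_apply (x : genSubalgebra t) : genIncl t x = toKS (x : OuterAlg K) := rfl

theorem IsGrouplike.isGradedBialgebra (ht : IsGrouplike t) :
    letI := ht.bialgebra
    IsGradedBialgebra K (wordSpan t) (genSubalgebra t) (genIncl t) :=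
  letI := ht.bialgebra
  { injective := toKS.injective.comp Subtype.val_injective
    range_eq := by
      ext x
      obtain ⟨x, rfl⟩ := toKS.surjective x
      rw [toKS_mem_iSup_wordSpan_iff]
      constructor
      · rintro ⟨y, hy⟩
        rw [← toKS.injective hy]
        exact y.2
      · exact fun h => ⟨⟨x, h⟩, rfl⟩
    map_one := rfl
    map_mul := fun _ _ => rfl
    map_comul := fun a => by
      have h := congrArg (TensorProduct.congr toKS toKS) (ht.genTensorVal_comul a)
      have e : TensorProduct.congr toKS toKS (outerComul K (a : OuterAlg K)) =
          coprod K (toKS (a : OuterAlg K)) := by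
        simp [outerComul]
      rw [e] at h
      rw [genIncl_apply, ← h, genIncl, TensorProduct.map_comp]
      rfl
    map_counit := fun _ => rfl
    direct := iSupIndep_degreePart.mono ht.wordSpan_le
    one_mem := prod_mem_wordSpan t []
    mul_mem := fun _ _ _ hx _ hy => outerProd_mem_wordSpan hx hy
    comul_mem := fun _ _ hx => ht.coprod_mem hx
    counit_eq_zero := fun n hn x hx => by
      rw [counitMap_eq_val]
      exact val_eq_zero_of_mem_degreePart (ht.wordSpan_le n hx) (by simpa using Ne.symm hn) }

/-- Inner right multiplication with a group-like series is a homomorphism with respect to the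
outer product. -/
def IsGrouplike.rightMulHom (ht : IsGrouplike t) : OuterAlg K →ₐ[K] OuterAlg K :=
  AlgHom.ofLinearMap
    (toKS.symm.toLinearMap ∘ₗ rightMul K (fun n => toKS (t n)) ∘ₗ toKS.toLinearMap)
    (toKS.injective (by
      change rightMul K (fun n => toKS (t n)) (outerOne K) = outerOne K
      rw [outerOne, rightMul_ofPerm, ht.zero, toKS_one,
        innerProd_ofPerm_one outerOne_mem_degreePart, outerOne]))
    (fun x y => by
      simp only [LinearMap.comp_apply, LinearEquiv.coe_coe]
      induction x using OuterAlg_induction with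
      | add a b ha hb => simp [add_mul, ha, hb]
      | smul c a ha => simp [ha]
      | ofPerm n α =>
        induction y using OuterAlg_induction with
        | add a b ha hb => simp [mul_add, ha, hb]
        | smul c a ha => simp [ha]
        | ofPerm m β =>
          have hd : toKS (toKS.symm (ofPerm K α) * toKS.symm (ofPerm K β)) ∈
              degreePart K (n + m) :=
            outerProd_mem_degreePart (ofPerm_mem_degreePart α) (ofPerm_mem_degreePart β)
          rw [rightMul_of_mem_degreePart _ hd]
          change inner K (toKS.symm (ofPerm K α) * toKS.symm (ofPerm K β)) (t (n + m)) = _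
          -- Inner products of different degrees vanish, which leaves only `t n ⊗ t m`.
          rw [(ht.isSplit (n + m)).inner_mul, map_sum, map_sum, Finset.sum_eq_single (n, m)]
          · simp only [LinearEquiv.apply_symm_apply, rightMul_ofPerm]
            rfl
          · rintro ⟨i, j⟩ hp h
            have : i ≠ n := by
              rintro rfl
              simp at hp h
              exact h hp
            rw [TensorProduct.map_tmul, LinearMap.mul'_apply]
            have : inner K (toKS.symm (ofPerm K α)) (t i) = 0 :=
              toKS.injective (innerProd_ofPerm_of_mem_degreePart_ne this α (ht.mem_degreePart i))
            rw [this, zero_mul]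
          · simp)

theorem IsGrouplike.toKS_rightMulHom (ht : IsGrouplike t) (x : OuterAlg K) :
    toKS (ht.rightMulHom x) = rightMul K (fun n => toKS (t n)) (toKS x) := rfl

/-- The homomorphism of bialgebras with `s n ↦ t n`, if it is induced by an endomorphism of
the outer algebra. -/
theorem exists_bialgHom (hs : IsGrouplike s) (ht : IsGrouplike t)
    (R : OuterAlg K →ₐ[K] OuterAlg K) (hR : ∀ n, R (s n) = t n) :
    letI := hs.bialgebra
    letI := ht.bialgebra
    ∃ f : genSubalgebra s →ₐc[K] genSubalgebra t,
      (∀ a, (f a : OuterAlg K) = R a) ∧ Function.Surjective f := by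
  let _ := hs.bialgebra
  let _ := ht.bialgebra
  -- Generators go to generators; one inclusion gives the codomain of the restricted map, the other
  -- its surjectivity.
  have hmap : (genSubalgebra s).map R = genSubalgebra t := by
    rw [AlgHom.map_adjoin, ← Set.range_comp]
    congr 2
    exact funext hR
  have hmem : ∀ a : genSubalgebra s, R.comp (genSubalgebra s).val a ∈ genSubalgebra t := fun a => by
    rw [← hmap]
    exact ⟨a, a.2, rfl⟩
  let f₀ : genSubalgebra s →ₐ[K] genSubalgebra t := (R.comp (genSubalgebra s).val).codRestrict _ hmem
  have hgen : ∀ n, f₀ (gen s n) = gen t n := fun n => Subtype.ext (hR n)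
  refine ⟨BialgHom.ofAlgHom f₀ (genSubalgebra_hom_ext fun n => ?_)
    (genSubalgebra_hom_ext fun n => ?_), fun a => rfl, ?_⟩
  · rw [AlgHom.comp_apply, hgen]
    exact (ht.outerCounit_eq n).trans (hs.outerCounit_eq n).symm
  · rw [AlgHom.comp_apply, AlgHom.comp_apply, hgen]
    change Algebra.TensorProduct.map f₀ f₀ (hs.comul (gen s n)) = ht.comul (gen t n)
    rw [hs.comul_gen, ht.comul_gen, map_sum]
    simp [hgen]
  · intro b
    obtain ⟨a, ha, e⟩ := hmap.ge b.2
    exact ⟨⟨a, ha⟩, Subtype.ext e⟩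

end Grouplike

/-! ### Descents, peaks and cuts of words -/

section Statistics

/-- The word `w` has a descent at its letter number `i`, counted from `0`. -/
def DesAt (w : List ℕ) (i : ℕ) : Prop := ∃ h : i + 1 < w.length, w[i + 1] < w[i]

/-- The letter number `i + 1` of the word `w`, counted from `0`, is a peak. -/
def PeakAt (w : List ℕ) (i : ℕ) : Prop :=
  ∃ h : i + 2 < w.length, w[i] < w[i + 1] ∧ w[i + 2] < w[i + 1]

theorem desAt_take (w : List ℕ) (k i : ℕ) : DesAt (w.take k) i ↔ i + 1 < k ∧ DesAt w i := by
  simp only [DesAt, List.length_take, List.getElem_take, lt_min_iff]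
  exact ⟨fun ⟨h, h'⟩ => ⟨h.1, h.2, h'⟩, fun ⟨h, h', h''⟩ => ⟨⟨h, h'⟩, h''⟩⟩

theorem desAt_drop (w : List ℕ) (k i : ℕ) : DesAt (w.drop k) i ↔ DesAt w (k + i) := by
  simp only [DesAt, List.length_drop, List.getElem_drop, ← add_assoc]
  constructor
  · rintro ⟨h, h'⟩
    exact ⟨by omega, h'⟩
  · rintro ⟨h, h'⟩
    exact ⟨by omega, h'⟩

theorem peakAt_take (w : List ℕ) (k i : ℕ) : PeakAt (w.take k) i ↔ i + 2 < k ∧ PeakAt w i := by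
  simp only [PeakAt, List.length_take, List.getElem_take, lt_min_iff]
  exact ⟨fun ⟨h, h'⟩ => ⟨h.1, h.2, h'⟩, fun ⟨h, h', h''⟩ => ⟨⟨h, h'⟩, h''⟩⟩

theorem peakAt_drop (w : List ℕ) (k i : ℕ) : PeakAt (w.drop k) i ↔ PeakAt w (k + i) := by
  simp only [PeakAt, List.length_drop, List.getElem_drop, ← add_assoc]
  constructor
  · rintro ⟨h, h'⟩
    exact ⟨by omega, h'⟩
  · rintro ⟨h, h'⟩
    exact ⟨by omega, h'⟩

theorem peakAt_cons_succ (a : ℕ) (w : List ℕ) (i : ℕ) : PeakAt (a :: w) (i + 1) ↔ PeakAt w i :=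
  ⟨fun ⟨h, h'⟩ => ⟨Nat.lt_of_succ_lt_succ h, h'⟩, fun ⟨h, h'⟩ => ⟨Nat.succ_lt_succ h, h'⟩⟩

theorem pairwise_lt_iff_forall_not_desAt {w : List ℕ} (hw : w.Nodup) :
    w.Pairwise (· < ·) ↔ ∀ i, ¬ DesAt w i := by
  rw [← List.isChain_iff_pairwise, List.isChain_iff_getElem]
  constructor
  · rintro h i ⟨hi, hlt⟩
    exact absurd (h i hi) (by omega)
  · intro h i hi
    have h1 : ¬ w[i + 1] < w[i] := fun h' => h i ⟨hi, h'⟩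
    have h2 : w[i] ≠ w[i + 1] := fun e => by
      have := (List.Nodup.getElem_inj_iff hw).1 e
      omega
    omega

/-- After an ascent, the first descent would create a peak. -/
theorem forall_not_peakAt_iff_of_lt {x y : ℕ} {l : List ℕ} (hl : (y :: l).Nodup) (hxy : x < y) :
    (∀ i, ¬ PeakAt (x :: y :: l) i) ↔ (y :: l).Pairwise (· < ·) := by
  rw [← List.isChain_iff_pairwise]
  induction l generalizing x y with
  | nil => simp [PeakAt]
  | cons z l ih =>
    rw [List.isChain_cons_cons]
    have hyz : y ≠ z := by
      rintro rfl
      simp at hl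
    have h0 : PeakAt (x :: y :: z :: l) 0 ↔ z < y := by simp [PeakAt, hxy]
    constructor
    · intro h
      have h1 : y < z := by
        have := h 0
        rw [h0] at this
        omega
      exact ⟨h1, (ih (List.nodup_cons.1 hl).2 h1).1 fun i hi =>
        h (i + 1) ((peakAt_cons_succ _ _ _).2 hi)⟩
    · rintro ⟨h1, h2⟩ i hi
      cases i with
      | zero =>
        rw [h0] at hi
        omega
      | succ i => exact (ih (List.nodup_cons.1 hl).2 h1).2 h2 i ((peakAt_cons_succ _ _ _).1 hi)

open Classical in
-- The left side counts the cuts of `w` into a decreasing and an increasing word. A nonempty word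
-- without peaks falls to its minimum and then rises, and it can be cut just before or just after
-- the minimum; a peak rules out every cut.
theorem conv_dec_inc {R : Type*} [CommRing R] {w : List ℕ} (hw : w.Nodup) :
    conv (fun l => if l.Pairwise (· > ·) then (1 : R) else 0)
      (fun l => if l.Pairwise (· < ·) then (1 : R) else 0) w =
      if w = [] then 1 else if ∀ i, ¬ PeakAt w i then 2 else 0 := by
  induction w with
  | nil => simp [conv_nil]
  | cons x w ih =>
    cases w with
    | nil =>
      rw [conv_cons, conv_nil]
      simp [PeakAt]
      norm_num
    | cons y l =>
      have hl := (List.nodup_cons.1 hw).2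
      have ih := ih hl
      rw [conv_cons] at ih
      rw [conv_cons, conv_cons]
      simp only [List.Pairwise.nil, if_true, one_mul, List.pairwise_singleton, reduceCtorEq,
        if_false] at ih ⊢
      have hxy : x ≠ y := by
        rintro rfl
        simp at hw
      -- If `x < y`, the decreasing prefix has at most one letter. If `x > y`, it is not empty, and
      -- removing `x` from it gives a bijection with the cuts of `y :: l`.
      rcases lt_or_gt_of_ne hxy with h | h
      · have h1 : ∀ l : List ℕ, ¬ (x :: y :: l).Pairwise (· > ·) := fun l hp => by
          have := (List.pairwise_cons.1 hp).1 y (by simp)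
          omega
        have h2 : (x :: y :: l).Pairwise (· < ·) ↔ (y :: l).Pairwise (· < ·) := by
          rw [← List.isChain_iff_pairwise, ← List.isChain_iff_pairwise, List.isChain_cons_cons]
          simp [h]
        simp only [h1, if_false, h2, forall_not_peakAt_iff_of_lt hl h]
        have : conv (fun _ : List ℕ => (0 : R))
            (fun l => if l.Pairwise (· < ·) then (1 : R) else 0) l = 0 := by
          simp [conv]
        rw [this]
        split_ifs <;> norm_num
      · have h1 : ∀ l : List ℕ, (x :: y :: l).Pairwise (· > ·) ↔ (y :: l).Pairwise (· > ·) :=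
          fun l => by
            rw [← List.isChain_iff_pairwise, ← List.isChain_iff_pairwise, List.isChain_cons_cons]
            simp [h]
        have h2 : ¬ (x :: y :: l).Pairwise (· < ·) := fun hp => by
          have := (List.pairwise_cons.1 hp).1 y (by simp)
          omega
        have h3 : (∀ i, ¬ PeakAt (x :: y :: l) i) ↔ ∀ i, ¬ PeakAt (y :: l) i := by
          constructor
          · exact fun H i hi => H (i + 1) ((peakAt_cons_succ _ _ _).2 hi)
          · intro H i hi
            cases i with
            | zero =>
              obtain ⟨_, h4, -⟩ := hi
              simp at h4
              omega
            | succ i => exact H i ((peakAt_cons_succ _ _ _).1 hi)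
        simp only [h1, h2, if_false, zero_add, h3]
        exact ih

/-- The proper nonempty partial sums of a list. -/
def IsCut (l : List ℕ) (i : ℕ) : Prop := ∃ j, 1 ≤ j ∧ j < l.length ∧ (l.take j).sum = i

theorem isCut_cons (a : ℕ) (l : List ℕ) (i : ℕ) :
    IsCut (a :: l) i ↔ l ≠ [] ∧ (i = a ∨ ∃ k, i = a + k ∧ IsCut l k) := by
  constructor
  · rintro ⟨j, h1, h2, rfl⟩
    obtain ⟨j, rfl⟩ : ∃ k, j = k + 1 := ⟨j - 1, by omega⟩
    simp only [List.length_cons] at h2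
    refine ⟨by rintro rfl; simp at h2, ?_⟩
    rcases Nat.eq_zero_or_pos j with rfl | hj
    · simp
    · exact Or.inr ⟨_, by simp, j, hj, by omega, rfl⟩
  · rintro ⟨hl, rfl | ⟨k, rfl, j, h1, h2, rfl⟩⟩
    · have := List.length_pos_iff.2 hl
      exact ⟨1, le_rfl, by simpa using this, by simp⟩
    · exact ⟨j + 1, by omega, by simpa using h2, by simp⟩

theorem isCut_concat {l : List ℕ} (hl : l ≠ []) (c i : ℕ) :
    IsCut (l ++ [c]) i ↔ IsCut l i ∨ i = l.sum := by
  have hpos := List.length_pos_iff.2 hl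
  constructor
  · rintro ⟨j, h1, h2, rfl⟩
    simp only [List.length_append, List.length_singleton] at h2
    rcases Nat.lt_or_ge j l.length with h | h
    · exact Or.inl ⟨j, h1, h, by rw [List.take_append_of_le_length h.le]⟩
    · have : j = l.length := by omega
      subst this
      simp
  · rintro (⟨j, h1, h2, rfl⟩ | rfl)
    · exact ⟨j, h1, by simp; omega, by rw [List.take_append_of_le_length h2.le]⟩
    · exact ⟨l.length, hpos, by simp, by simp⟩

/-- The largest element `m` of `S` becomes the last cut: a list with sum `m` for the smaller
elements is followed by `n - m`. Parts equal to `0` are allowed, so `n` itself may be a cut. -/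
theorem exists_isCut_iff (S : Finset ℕ) :
    ∀ n, (∀ i ∈ S, 1 ≤ i ∧ i ≤ n) → ∃ l : List ℕ, l.sum = n ∧ ∀ i, IsCut l i ↔ i ∈ S := by
  induction S using Finset.induction_on_max with
  | empty => exact fun n _ => ⟨[n], by simp, fun i => by simp [isCut_cons]⟩
  | insert m S hm ih =>
    intro n hn
    obtain ⟨l, hl, hS⟩ := ih m fun i hi =>
      ⟨(hn i (Finset.mem_insert_of_mem hi)).1, (hm i hi).le⟩
    have h1 := hn m (Finset.mem_insert_self _ _)
    refine ⟨l ++ [n - m], by simp [hl]; omega, fun i => ?_⟩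
    rw [isCut_concat (by rintro rfl; simp at hl; omega), hS, hl, Finset.mem_insert, or_comm]

theorem forall_desAt_cons_iff (a : ℕ) (l : List ℕ) (w : List ℕ) (hw : w.length = a + l.sum) :
    (∀ i, DesAt w i → IsCut (a :: l) (i + 1)) ↔
      (∀ i, ¬ DesAt (w.take a) i) ∧ ∀ i, DesAt (w.drop a) i → IsCut l (i + 1) := by
  simp only [desAt_take, desAt_drop, isCut_cons]
  constructor
  · intro h
    refine ⟨fun i hi => ?_, fun i hi => ?_⟩
    · rcases (h i hi.2).2 with h' | ⟨k, h', -⟩ <;> omega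
    · rcases (h _ hi).2 with h' | ⟨k, h', hk⟩
      · omega
      · obtain rfl : k = i + 1 := by omega
        exact hk
  · rintro ⟨h1, h2⟩ i hi
    have hl : a ≤ i + 1 → l ≠ [] := by
      rintro h rfl
      obtain ⟨h', -⟩ := hi
      simp at hw
      omega
    rcases lt_trichotomy (i + 1) a with h | h | h
    · exact absurd ⟨h, hi⟩ (h1 i)
    · exact ⟨hl h.ge, Or.inl h⟩
    · obtain ⟨k, rfl⟩ : ∃ k, i = a + k := ⟨i - a, by omega⟩
      exact ⟨hl h.le, Or.inr ⟨k + 1, by omega, h2 k hi⟩⟩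

/-- The three letters of a peak lie in one block unless a cut separates its top from a neighbour.
For the letters numbered `i`, `i + 1`, `i + 2` from zero, such a cut comes after `i + 1` or `i + 2`
letters. -/
theorem forall_peakAt_cons_iff (a : ℕ) (l : List ℕ) (w : List ℕ) (hw : w.length = a + l.sum) :
    (∀ i, PeakAt w i → IsCut (a :: l) (i + 1) ∨ IsCut (a :: l) (i + 2)) ↔
      (∀ i, ¬ PeakAt (w.take a) i) ∧
        ∀ i, PeakAt (w.drop a) i → IsCut l (i + 1) ∨ IsCut l (i + 2) := by
  simp only [peakAt_take, peakAt_drop, isCut_cons]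
  constructor
  · intro h
    refine ⟨fun i hi => ?_, fun i hi => ?_⟩
    · rcases h i hi.2 with ⟨-, h' | ⟨k, h', -⟩⟩ | ⟨-, h' | ⟨k, h', -⟩⟩ <;> omega
    · rcases h _ hi with ⟨-, h' | ⟨k, h', hk⟩⟩ | ⟨-, h' | ⟨k, h', hk⟩⟩
      · omega
      · obtain rfl : k = i + 1 := by omega
        exact Or.inl hk
      · omega
      · obtain rfl : k = i + 2 := by omega
        exact Or.inr hk
  · rintro ⟨h1, h2⟩ i hi
    have hl : a ≤ i + 2 → l ≠ [] := by
      rintro h rfl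
      obtain ⟨h', -⟩ := hi
      simp at hw
      omega
    rcases lt_trichotomy (i + 2) a with h | h | h
    · exact absurd ⟨h, hi⟩ (h1 i)
    · exact Or.inr ⟨hl h.ge, Or.inl h⟩
    · rcases Nat.lt_or_ge a (i + 1) with h' | h'
      · obtain ⟨k, rfl⟩ : ∃ k, i = a + k := ⟨i - a, by omega⟩
        rcases h2 k hi with h3 | h3
        · exact Or.inl ⟨hl h.le, Or.inr ⟨k + 1, by omega, h3⟩⟩
        · exact Or.inr ⟨hl h.le, Or.inr ⟨k + 2, by omega, h3⟩⟩
      · exact Or.inl ⟨hl h.le, Or.inl (by omega)⟩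

theorem desSet_subset {n : ℕ} (π : Equiv.Perm (Fin n)) : desSet π ⊆ Finset.Icc 1 (n - 1) :=
  Finset.filter_subset _ _

theorem peakSet_subset {n : ℕ} (π : Equiv.Perm (Fin n)) : peakSet π ⊆ Finset.Icc 2 (n - 1) :=
  Finset.filter_subset _ _

theorem IsPattern.mem_desSet_iff {n : ℕ} {π : Equiv.Perm (Fin n)} {w : List ℕ}
    (h : IsPattern ⟨n, π⟩ w) (i : ℕ) : i + 1 ∈ desSet π ↔ DesAt w i := by
  obtain ⟨g, rfl, hg⟩ := h
  simp only [desSet, Finset.mem_filter, Finset.mem_Icc, DesAt, List.length_ofFn, List.getElem_ofFn,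
    hg]
  constructor
  · rintro ⟨-, ⟨a, ha⟩, ⟨b, hb⟩, h1, h2, h3⟩
    simp only [add_left_inj] at h1 h2
    subst h1 h2
    exact ⟨hb, h3⟩
  · rintro ⟨h1, h2⟩
    exact ⟨by omega, _, _, rfl, rfl, h2⟩

theorem IsPattern.mem_peakSet_iff {n : ℕ} {π : Equiv.Perm (Fin n)} {w : List ℕ}
    (h : IsPattern ⟨n, π⟩ w) (i : ℕ) : i + 2 ∈ peakSet π ↔ PeakAt w i := by
  obtain ⟨g, rfl, hg⟩ := h
  simp only [peakSet, Finset.mem_filter, Finset.mem_Icc, PeakAt, List.length_ofFn,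
    List.getElem_ofFn, hg]
  constructor
  · rintro ⟨-, ⟨a, ha⟩, ⟨b, hb⟩, ⟨c, hc⟩, h1, h2, h3, h4⟩
    obtain rfl : a = i := by simp at h1; omega
    obtain rfl : b = a + 1 := by simp at h2; omega
    obtain rfl : c = a + 2 := by simp at h3; omega
    exact ⟨hc, h4⟩
  · rintro ⟨h1, h2⟩
    exact ⟨by omega, _, _, _, by simp, rfl, rfl, h2⟩

theorem not_mem_peakSet_succ {n : ℕ} (π : Equiv.Perm (Fin n)) {p : ℕ} (h : p ∈ peakSet π) :
    p + 1 ∉ peakSet π := by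
  intro h'
  have hp := (Finset.mem_Icc.1 (peakSet_subset π h)).1
  obtain ⟨i, rfl⟩ : ∃ i, p = i + 2 := ⟨p - 2, by omega⟩
  have hw := isPattern_shiftWord 0 ⟨n, π⟩
  obtain ⟨_, h1, h2⟩ := (hw.mem_peakSet_iff i).1 h
  obtain ⟨_, h3, h4⟩ := (hw.mem_peakSet_iff (i + 1)).1 h'
  exact lt_asymm h2 h3

/-- For `p ≥ 2`, a peak at `p` is a descent at `p` without a descent at `p - 1`. This puts the peak
algebra inside the descent algebra. -/
theorem peakSet_eq_of_desSet_eq {n : ℕ} {π ρ : Equiv.Perm (Fin n)} (h : desSet π = desSet ρ) :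
    peakSet π = peakSet ρ := by
  have key : ∀ (σ : Equiv.Perm (Fin n)) (p : ℕ),
      p ∈ peakSet σ ↔ 2 ≤ p ∧ p ≤ n - 1 ∧ p ∈ desSet σ ∧ p - 1 ∉ desSet σ := by
    intro σ p
    by_cases hp : 2 ≤ p
    · obtain ⟨i, rfl⟩ : ∃ i, p = i + 2 := ⟨p - 2, by omega⟩
      have hw := isPattern_shiftWord 0 ⟨n, σ⟩
      have hnd := nodup_shiftWord 0 ⟨n, σ⟩
      rw [hw.mem_peakSet_iff, show i + 2 - 1 = i + 1 from rfl, hw.mem_desSet_iff i,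
        show i + 2 = (i + 1) + 1 from rfl, hw.mem_desSet_iff (i + 1)]
      have hlen : (shiftWord 0 ⟨n, σ⟩).length = n := hw.length_eq
      constructor
      · rintro ⟨h1, h2, h3⟩
        refine ⟨by omega, by omega, ⟨h1, h3⟩, ?_⟩
        rintro ⟨_, h4⟩
        exact lt_asymm h2 h4
      · rintro ⟨-, h1, ⟨h2, h3⟩, h4⟩
        refine ⟨h2, ?_, h3⟩
        by_contra h5
        refine h4 ⟨by omega, lt_of_le_of_ne (not_lt.1 h5) fun e => ?_⟩
        have := (List.Nodup.getElem_inj_iff hnd).1 e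
        omega
    · constructor
      · intro h
        exact absurd (Finset.mem_Icc.1 (peakSet_subset σ h)).1 hp
      · exact fun h => absurd h.1 hp
  ext p
  rw [key, key, h]

end Statistics

/-! ### Elements whose coefficients depend on a statistic -/

section Statistic

variable {K : Type u} [Field K] {n : ℕ}

/-- The sum of all permutations with a given value of a statistic. -/
def statSum (K : Type u) [Field K] (f : Equiv.Perm (Fin n) → Finset ℕ) (D : Finset ℕ) : KS K :=
  ∑ π : Equiv.Perm (Fin n) with f π = D, ofPerm K π

theorem statSum_apply (f : Equiv.Perm (Fin n) → Finset ℕ) (D : Finset ℕ)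
    (π : Equiv.Perm (Fin n)) : statSum K f D ⟨n, π⟩ = if f π = D then 1 else 0 := by
  rw [statSum, Finsupp.finsetSum_apply]
  simp [ofPerm, Finsupp.single_apply]

theorem statSum_mem_degreePart (f : Equiv.Perm (Fin n) → Finset ℕ) (D : Finset ℕ) :
    statSum K f D ∈ degreePart K n :=
  Submodule.sum_mem _ fun π _ => ofPerm_mem_degreePart π

theorem eq_of_apply_eq {x y : KS K} (hx : x ∈ degreePart K n) (hy : y ∈ degreePart K n)
    (h : ∀ π : Equiv.Perm (Fin n), x ⟨n, π⟩ = y ⟨n, π⟩) : x = y := by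
  ext ⟨m, π⟩
  by_cases hm : m = n
  · subst hm
    exact h π
  · rw [(Finsupp.mem_supported' K x).1 hx _ hm, (Finsupp.mem_supported' K y).1 hy _ hm]

theorem eq_sum_statSum (f : Equiv.Perm (Fin n) → Finset ℕ) {U : Finset ℕ} (hU : ∀ π, f π ⊆ U)
    {x : KS K} (hx : x ∈ degreePart K n) (c : Finset ℕ → K)
    (h : ∀ π : Equiv.Perm (Fin n), x ⟨n, π⟩ = c (f π)) :
    x = ∑ D ∈ U.powerset, c D • statSum K f D := by
  refine eq_of_apply_eq hx (Submodule.sum_mem _ fun D _ => Submodule.smul_mem _ _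
    (statSum_mem_degreePart f D)) fun π => ?_
  rw [h, Finsupp.finsetSum_apply]
  simp only [Finsupp.smul_apply, statSum_apply, smul_eq_mul, mul_ite, mul_one, mul_zero]
  rw [Finset.sum_ite_eq, if_pos (Finset.mem_powerset.2 (hU π))]

theorem descentSum_eq_statSum (D : Finset ℕ) : descentSum K n D = statSum K (desSet (n := n)) D := rfl

theorem peakSum_eq_statSum (P : Finset ℕ) : peakSum K n P = statSum K (peakSet (n := n)) P := rfl

/-- Homogeneous elements whose coefficients depend on the descent set. -/
theorem mem_descentAlg {x : KS K} (hx : x ∈ degreePart K n) (c : Finset ℕ → K)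
    (h : ∀ π : Equiv.Perm (Fin n), x ⟨n, π⟩ = c (desSet π)) : x ∈ descentAlg K n := by
  rw [eq_sum_statSum desSet desSet_subset hx c h]
  exact Submodule.sum_mem _ fun D hD => Submodule.smul_mem _ _
    (Submodule.subset_span ⟨D, Finset.mem_powerset.1 hD, rfl⟩)

/-- Homogeneous elements whose coefficients depend on the peak set. -/
theorem mem_peakAlg {x : KS K} (hx : x ∈ degreePart K n) (c : Finset ℕ → K)
    (h : ∀ π : Equiv.Perm (Fin n), x ⟨n, π⟩ = c (peakSet π)) : x ∈ peakAlg K n := by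
  rw [eq_sum_statSum peakSet peakSet_subset hx c h]
  exact Submodule.sum_mem _ fun D hD => Submodule.smul_mem _ _
    (Submodule.subset_span ⟨D, Finset.mem_powerset.1 hD, rfl⟩)

theorem peakAlg_le_descentAlg (n : ℕ) : peakAlg K n ≤ descentAlg K n := by
  refine Submodule.span_le.2 ?_
  rintro _ ⟨P, -, rfl⟩
  rw [peakSum_eq_statSum]
  classical
  refine mem_descentAlg (statSum_mem_degreePart _ _)
    (fun D => if ∃ π : Equiv.Perm (Fin n), desSet π = D ∧ peakSet π = P then 1 else 0) fun π => ?_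
  rw [statSum_apply]
  congr 1
  rw [eq_iff_iff]
  exact ⟨fun h => ⟨π, rfl, h⟩, fun ⟨ρ, h1, h2⟩ => (peakSet_eq_of_desSet_eq h1).symm.trans h2⟩

end Statistic

/-! ### The series of identities and of `Ξ̃^n`, and the spaces they generate -/

section Families

variable {K : Type u} [Field K]

theorem IsShuffleChar.congr {R α : Type*} [CommSemiring R] {F G : List α → R}
    (hF : IsShuffleChar F) (h : ∀ w : List α, w.Nodup → F w = G w) : IsShuffleChar G := by
  intro u v huv
  rw [← h u (huv.sublist (List.sublist_append_left _ _)),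
    ← h v (huv.sublist (List.sublist_append_right _ _)), ← hF u v huv]
  exact shuffleSum_congr fun l hl => (h l (hl.nodup_iff.2 huv)).symm

variable (K) in
/-- The identity permutations. -/
def idFamily (n : ℕ) : OuterAlg K := toKS.symm (ofPerm K (1 : Equiv.Perm (Fin n)))

variable (K) in
/-- The elements `Ξ̃^n`. -/
def tXiFamily (n : ℕ) : OuterAlg K := toKS.symm (tXiNat K n)

open Classical in
theorem val_idFamily (w : List ℕ) :
    val K (toKS (idFamily K w.length)) w = if w.Pairwise (· < ·) then 1 else 0 := by
  have : ∀ n, w.length = n →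
      val K (toKS (idFamily K n)) w = if w.Pairwise (· < ·) then 1 else 0 := by
    intro n hn
    obtain ⟨g, rfl⟩ : ∃ g : Fin n → ℕ, w = List.ofFn g := by
      subst hn
      exact ⟨w.get, (List.ofFn_get w).symm⟩
    rw [idFamily, LinearEquiv.apply_symm_apply, val_ofPerm, isPattern_ofFn]
    have : (∀ i j : Fin n, g i < g j ↔ (1 : Equiv.Perm (Fin n)) i < (1 : Equiv.Perm (Fin n)) j) ↔
        (List.ofFn g).Pairwise (· < ·) := by
      rw [List.pairwise_ofFn]
      exact ⟨fun h i j hij => (h i j).2 hij,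
        fun h i j => StrictMono.lt_iff_lt (f := g) fun i j => @h i j⟩
    simp only [this]
  exact this _ rfl

theorem isGrouplike_idFamily : IsGrouplike (idFamily K) where
  zero := rfl
  mem_degreePart _ := ofPerm_mem_degreePart _
  char := by
    classical
    exact (isShuffleChar_pairwise (R := K) (fun a b : ℕ => a < b)).congr fun w _ => by
      rw [val_idFamily]
      congr

theorem tXiNat_mem_degreePart (n : ℕ) : tXiNat K n ∈ degreePart K n := by
  unfold tXiNat
  split_ifs with h
  · subst h
    exact outerOne_mem_degreePart
  · exact Submodule.smul_mem _ _ (statSum_mem_degreePart _ _)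

open Classical in
theorem val_tXiFamily {w : List ℕ} (hw : w.Nodup) :
    val K (toKS (tXiFamily K w.length)) w =
      if w = [] then 1 else if ∀ i, ¬ PeakAt w i then 2 else 0 := by
  rw [tXiFamily, LinearEquiv.apply_symm_apply, tXiNat]
  by_cases h : w = []
  · subst h
    rw [List.length_nil, if_pos rfl, val_outerOne]
    rfl
  · rw [if_neg h, if_neg (by simpa using h)]
    obtain ⟨⟨n, π⟩, hp⟩ := exists_isPattern hw
    have hn := hp.length_eq
    simp only at hn
    rw [hn, hp.val_eq, peakSum_eq_statSum, Finsupp.smul_apply, statSum_apply]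
    have : peakSet π = ∅ ↔ ∀ i, ¬ PeakAt w i := by
      simp only [← hp.mem_peakSet_iff]
      constructor
      · exact fun h i => by simp [h]
      · refine fun h => Finset.eq_empty_of_forall_notMem fun p hp => ?_
        have := (Finset.mem_Icc.1 (peakSet_subset π hp)).1
        exact h (p - 2) (by rwa [Nat.sub_add_cancel this])
    simp [this]

/-- On words, `Ξ̃` is the convolution of the shuffle characters of decreasing and of increasing
words. -/
theorem isGrouplike_tXiFamily : IsGrouplike (tXiFamily K) where
  zero := rfl
  mem_degreePart n := tXiNat_mem_degreePart n
  char := by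
    classical
    refine IsShuffleChar.congr
      ((isShuffleChar_pairwise (R := K) (fun a b : ℕ => a > b)).conv
        (isShuffleChar_pairwise (R := K) (fun a b : ℕ => a < b))) fun w hw => ?_
    rw [val_tXiFamily hw, ← conv_dec_inc hw]
    congr!

theorem val_prod_cons {t : ℕ → OuterAlg K} (ht : IsGrouplike t) (a : ℕ) (l : List ℕ)
    {w : List ℕ} (hw : w.Nodup) (ha : a ≤ w.length) :
    val K (toKS ((a :: l).map t).prod) w =
      val K (toKS (t (w.take a).length)) (w.take a) * val K (toKS (l.map t).prod) (w.drop a) := by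
  have hl : (w.take a).length = a := by simpa using ha
  rw [List.map_cons, List.prod_cons, val_mul _ _ hw]
  conv_lhs => rw [← List.take_append_drop a w]
  rw [conv_eq_of_length (fun _ h => val_eq_zero_of_mem_degreePart (ht.mem_degreePart a) h) _ _ hl,
    hl]

open Classical in
theorem val_prod_idFamily (l : List ℕ) {w : List ℕ} (hw : w.Nodup) (hl : w.length = l.sum) :
    val K (toKS (l.map (idFamily K)).prod) w =
      if ∀ i, DesAt w i → IsCut l (i + 1) then 1 else 0 := by
  induction l generalizing w with
  | nil =>
    obtain rfl : w = [] := List.eq_nil_of_length_eq_zero hl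
    rw [List.map_nil, List.prod_nil, val_one]
    simp [DesAt]
  | cons a l ih =>
    rw [List.sum_cons] at hl
    rw [val_prod_cons isGrouplike_idFamily a l hw (by omega), val_idFamily,
      ih (hw.sublist (List.drop_sublist _ _)) (by simp; omega)]
    simp only [forall_desAt_cons_iff a l w hl,
      pairwise_lt_iff_forall_not_desAt (hw.sublist (List.take_sublist _ _))]
    rw [ite_zero_mul_ite_zero, one_mul]

open Classical in
-- The constant is a power of 2 with one factor for each nonzero part of `l`. That it does not
-- vanish is what characteristic 0 is used for.
theorem val_prod_tXiFamily [CharZero K] (l : List ℕ) : ∃ c : K, c ≠ 0 ∧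
    ∀ w : List ℕ, w.Nodup → w.length = l.sum →
      val K (toKS (l.map (tXiFamily K)).prod) w =
        if ∀ i, PeakAt w i → IsCut l (i + 1) ∨ IsCut l (i + 2) then c else 0 := by
  induction l with
  | nil =>
    refine ⟨1, one_ne_zero, fun w _ hl => ?_⟩
    obtain rfl : w = [] := List.eq_nil_of_length_eq_zero hl
    rw [List.map_nil, List.prod_nil, val_one]
    simp [PeakAt]
  | cons a l ih =>
    obtain ⟨c, hc, ih⟩ := ih
    refine ⟨if a = 0 then c else 2 * c, by split_ifs <;> simp [hc], fun w hw hl => ?_⟩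
    rw [List.sum_cons] at hl
    rw [val_prod_cons isGrouplike_tXiFamily a l hw (by omega),
      val_tXiFamily (hw.sublist (List.take_sublist _ _)),
      ih _ (hw.sublist (List.drop_sublist _ _)) (by simp; omega)]
    simp only [forall_peakAt_cons_iff a l w hl]
    by_cases ha : a = 0
    · subst ha
      simp [PeakAt]
    · have : w.take a ≠ [] := by
        intro h
        have := congrArg List.length h
        rw [List.length_take, List.length_nil] at this
        omega
      rw [if_neg this, if_neg ha, ite_zero_mul_ite_zero]

open Classical in
theorem prod_idFamily_apply (l : List ℕ) (π : Equiv.Perm (Fin l.sum)) :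
    toKS (l.map (idFamily K)).prod ⟨l.sum, π⟩ =
      if ∀ d ∈ desSet π, IsCut l d then 1 else 0 := by
  have hp := isPattern_shiftWord 0 ⟨l.sum, π⟩
  rw [← hp.val_eq, val_prod_idFamily l (nodup_shiftWord _ _) hp.length_eq]
  simp only [← hp.mem_desSet_iff]
  congr 1
  rw [eq_iff_iff]
  constructor
  · intro h d hd
    have := (Finset.mem_Icc.1 (desSet_subset π hd)).1
    have := h (d - 1)
    rw [Nat.sub_add_cancel ‹1 ≤ d›] at this
    exact this hd
  · exact fun h i hi => h _ hi

open Classical in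
theorem prod_tXiFamily_apply [CharZero K] (l : List ℕ) : ∃ c : K, c ≠ 0 ∧
    ∀ π : Equiv.Perm (Fin l.sum), toKS (l.map (tXiFamily K)).prod ⟨l.sum, π⟩ =
      if ∀ p ∈ peakSet π, IsCut l (p - 1) ∨ IsCut l p then c else 0 := by
  obtain ⟨c, hc, h⟩ := val_prod_tXiFamily (K := K) l
  refine ⟨c, hc, fun π => ?_⟩
  have hp := isPattern_shiftWord 0 ⟨l.sum, π⟩
  rw [← hp.val_eq, h _ (nodup_shiftWord _ _) hp.length_eq]
  simp only [← hp.mem_peakSet_iff]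
  congr 1
  rw [eq_iff_iff]
  constructor
  · intro h d hd
    have := (Finset.mem_Icc.1 (peakSet_subset π hd)).1
    have := h (d - 2)
    rw [Nat.sub_add_cancel ‹2 ≤ d›, show d - 2 + 1 = d - 1 by omega] at this
    exact this hd
  · exact fun h i hi => h _ hi

/-- A product of identities is the sum of all `Δ^E` with `E` contained in the set of cuts. This is
unitriangular with respect to inclusion, and every `D` occurs as a set of cuts. -/
theorem wordSpan_idFamily (n : ℕ) : wordSpan (idFamily K) n = descentAlg K n := by
  classical
  apply le_antisymm
  · refine Submodule.span_le.2 ?_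
    rintro _ ⟨l, rfl, rfl⟩
    exact mem_descentAlg (isGrouplike_idFamily.prod_mem_degreePart l)
      (fun D => if ∀ d ∈ D, IsCut l d then 1 else 0) (prod_idFamily_apply l)
  · refine Submodule.span_le.2 ?_
    rintro _ ⟨D, hD, rfl⟩
    change D ⊆ _ at hD
    rw [SetLike.mem_coe]
    induction D using Finset.strongInduction with
    | H D ih =>
      obtain ⟨l, rfl, hS⟩ := exists_isCut_iff D n fun i hi => by
        have := Finset.mem_Icc.1 (hD hi)
        omega
      have h := eq_sum_statSum desSet desSet_subset (isGrouplike_idFamily.prod_mem_degreePart l)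
        (fun D => if ∀ d ∈ D, IsCut l d then (1 : K) else 0) (prod_idFamily_apply l)
      rw [← Finset.add_sum_erase _ _ (Finset.mem_powerset.2 hD),
        if_pos (fun d hd => (hS d).2 hd), one_smul] at h
      rw [descentSum_eq_statSum, ← sub_eq_iff_eq_add.2 h]
      refine sub_mem (prod_mem_wordSpan _ l) (Submodule.sum_mem _ fun E hE => ?_)
      rw [Finset.mem_erase, Finset.mem_powerset] at hE
      split_ifs with hE'
      · rw [one_smul]
        exact ih E (lt_of_le_of_ne (fun d hd => (hS d).1 (hE' d hd)) hE.1) hE.2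
      · rw [zero_smul]
        exact zero_mem _

/-- If a set `E` without consecutive elements consists of elements of `P` and their
predecessors, then its sum is smaller than that of `P`. -/
theorem sum_lt_sum_of_subset_pred {E P : Finset ℕ} (hE : ∀ p ∈ E, p + 1 ∉ E)
    (h : ∀ p ∈ E, p ∈ P ∨ p + 1 ∈ P) (hP : ∀ p ∈ P, 0 < p) (hne : E ≠ P) :
    ∑ p ∈ E, p < ∑ p ∈ P, p := by
  -- `φ` never decreases an element and maps `E` into `P`; it is injective, since a collision would
  -- produce consecutive elements of `E`.
  let φ : ℕ → ℕ := fun p => if p ∈ P then p else p + 1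
  have hφ : ∀ p ∈ E, φ p ∈ P := fun p hp => by
    simp only [φ]
    split_ifs with h'
    · exact h'
    · exact (h p hp).resolve_left h'
  have hinj : Set.InjOn φ E := by
    intro p hp q hq e
    simp only [φ] at e
    split_ifs at e with h1 h2 h2
    · exact e
    · subst e
      exact absurd hp (hE q hq)
    · subst e
      exact absurd hq (hE p hp)
    · omega
  have h1 : ∑ p ∈ E, φ p = ∑ p ∈ E.image φ, p := (Finset.sum_image (f := fun p => p) hinj).symm
  have h2 : E.image φ ⊆ P := Finset.image_subset_iff.2 hφ
  have h3 : ∀ p ∈ E, p ≤ φ p := fun p _ => by simp only [φ]; split_ifs <;> omega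
  by_cases hs : E ⊆ P
  · obtain ⟨q, hq, hqE⟩ := Finset.exists_of_ssubset (lt_of_le_of_ne hs hne)
    exact Finset.sum_lt_sum_of_subset hs hq hqE (hP q hq) fun _ _ _ => Nat.zero_le _
  · obtain ⟨q, hq, hqP⟩ := Finset.not_subset.1 hs
    refine lt_of_lt_of_le (Finset.sum_lt_sum h3 ⟨q, hq, ?_⟩)
      (h1.le.trans (Finset.sum_le_sum_of_subset h2))
    simp [φ, hqP]

theorem wordSpan_tXiFamily [CharZero K] (n : ℕ) : wordSpan (tXiFamily K) n = peakAlg K n := by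
  classical
  apply le_antisymm
  · refine Submodule.span_le.2 ?_
    rintro _ ⟨l, rfl, rfl⟩
    obtain ⟨c, -, h⟩ := prod_tXiFamily_apply (K := K) l
    exact mem_peakAlg (isGrouplike_tXiFamily.prod_mem_degreePart l)
      (fun P => if ∀ p ∈ P, IsCut l (p - 1) ∨ IsCut l p then c else 0) h
  · refine Submodule.span_le.2 ?_
    rintro _ ⟨P, hP, rfl⟩
    change P ⊆ _ at hP
    rw [SetLike.mem_coe]
    induction hm : ∑ p ∈ P, p using Nat.strong_induction_on generalizing P with
    | _ m ih =>
      -- Sets with consecutive elements are no peak sets, so their sums vanish; the comparison of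
      -- sums would fail for them.
      have hcons : ∀ (E : Finset ℕ) (p : ℕ), p ∈ E → p + 1 ∈ E → peakSum K n E = 0 := by
        intro E p h1 h2
        refine Finset.sum_eq_zero fun π hπ => ?_
        obtain rfl := (Finset.mem_filter.1 hπ).2
        exact absurd h2 (not_mem_peakSet_succ π h1)
      obtain ⟨l, rfl, hS⟩ := exists_isCut_iff (P.image fun p => p - 1) n fun i hi => by
        obtain ⟨p, hp, rfl⟩ := Finset.mem_image.1 hi
        have := Finset.mem_Icc.1 (hP hp)
        omega
      have hP1 : ∀ p ∈ P, 2 ≤ p := fun p hp => (Finset.mem_Icc.1 (hP hp)).1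
      obtain ⟨c, hc, h⟩ := prod_tXiFamily_apply (K := K) l
      have h := eq_sum_statSum peakSet peakSet_subset
        (isGrouplike_tXiFamily.prod_mem_degreePart l)
        (fun P => if ∀ p ∈ P, IsCut l (p - 1) ∨ IsCut l p then c else 0) h
      rw [← Finset.add_sum_erase _ _ (Finset.mem_powerset.2 hP),
        if_pos (fun p hp => Or.inl ((hS _).2 (Finset.mem_image_of_mem _ hp)))] at h
      have hmem : c • statSum K (peakSet (n := l.sum)) P ∈ wordSpan (tXiFamily K) l.sum := by
        rw [← sub_eq_iff_eq_add.2 h]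
        refine sub_mem (prod_mem_wordSpan _ l) (Submodule.sum_mem _ fun E hE => ?_)
        rw [Finset.mem_erase, Finset.mem_powerset] at hE
        split_ifs with hE'
        · refine Submodule.smul_mem _ _ ?_
          rw [← peakSum_eq_statSum]
          by_cases hEc : ∃ p ∈ E, p + 1 ∈ E
          · obtain ⟨p, h1, h2⟩ := hEc
            rw [hcons E p h1 h2]
            exact zero_mem _
          · push Not at hEc
            refine ih _ ?_ E hE.2 rfl
            rw [← hm]
            refine sum_lt_sum_of_subset_pred hEc (fun p hp => ?_)
              (fun p hp => by have := hP1 p hp; omega) hE.1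
            have hp2 := (Finset.mem_Icc.1 (hE.2 hp)).1
            simp only [hS, Finset.mem_image] at hE'
            rcases hE' p hp with ⟨q, hq, e⟩ | ⟨q, hq, e⟩
            · have := hP1 q hq
              obtain rfl : q = p := by omega
              exact Or.inl hq
            · have := hP1 q hq
              obtain rfl : q = p + 1 := by omega
              exact Or.inr hq
        · rw [zero_smul]
          exact zero_mem _
      rw [peakSum_eq_statSum, ← inv_smul_smul₀ hc (statSum K (peakSet (n := l.sum)) P)]
      exact Submodule.smul_mem _ _ hmem

/-! ### Compositions, Solomon's theorem and the left ideal property -/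

theorem isCut_blocks_iff {n : ℕ} (q : Composition n) (i : ℕ) :
    IsCut q.blocks i ↔ i ∈ partialSums q := by
  simp only [IsCut, partialSums, Finset.mem_image, Finset.mem_Ico, and_assoc]
  rfl

theorem Xi_eq {n : ℕ} (q : Composition n) : Xi K q = toKS (q.blocks.map (idFamily K)).prod := by
  classical
  obtain ⟨l, hpos, rfl⟩ := q
  set q : Composition l.sum := ⟨l, hpos, rfl⟩
  refine eq_of_apply_eq (Submodule.sum_mem _ fun D _ => statSum_mem_degreePart _ D)
    (isGrouplike_idFamily.prod_mem_degreePart l) fun π => ?_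
  have hcut : ∀ i, IsCut q.blocks i ↔ i ∈ partialSums q := isCut_blocks_iff q
  rw [prod_idFamily_apply, Xi, Finsupp.finsetSum_apply]
  simp only [descentSum_eq_statSum, statSum_apply, hcut]
  rw [Finset.sum_ite_eq]
  simp only [Finset.mem_powerset, Finset.subset_iff]

theorem tXi_eq {n : ℕ} (q : Composition n) :
    tXi K q = toKS (q.blocks.map (tXiFamily K)).prod := by
  rw [tXi]
  induction q.blocks with
  | nil => rfl
  | cons a l ih => rw [List.map_cons, List.foldr_cons, ih, List.map_cons, List.prod_cons]; rfl

theorem rightMulHom_idFamily (n : ℕ) :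
    isGrouplike_tXiFamily.rightMulHom (idFamily K n) = tXiFamily K n := by
  apply toKS.injective
  rw [IsGrouplike.toKS_rightMulHom, idFamily, LinearEquiv.apply_symm_apply, rightMul_ofPerm]
  exact innerProd_ofPerm_one (tXiNat_mem_degreePart n)

/-- Right multiplication with `Ξ̃` is multiplicative for the outer product and sends each identity
to the corresponding `Ξ̃^n`. -/
theorem innerProd_prod_idFamily (l : List ℕ) :
    innerProd K (toKS (l.map (idFamily K)).prod) (tXiNat K l.sum) =
      toKS (l.map (tXiFamily K)).prod := by
  have h := rightMul_of_mem_degreePart (tXiNat K) (isGrouplike_idFamily.prod_mem_degreePart l)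
  rw [← h]
  have h' := isGrouplike_tXiFamily.toKS_rightMulHom (K := K) (l.map (idFamily K)).prod
  rw [map_list_prod, List.map_map] at h'
  have e : isGrouplike_tXiFamily.rightMulHom ∘ idFamily K = tXiFamily K :=
    funext rightMulHom_idFamily
  rw [e] at h'
  exact h'.symm

theorem peakAlg_eq_map [CharZero K] (n : ℕ) :
    peakAlg K n = (descentAlg K n).map ((innerProd K).flip (tXiNat K n)) := by
  rw [← wordSpan_tXiFamily, ← wordSpan_idFamily, wordSpan, wordSpan, Submodule.map_span]
  congr 1
  ext x
  constructor
  · rintro ⟨l, rfl, rfl⟩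
    exact ⟨_, ⟨l, rfl, rfl⟩, innerProd_prod_idFamily l⟩
  · rintro ⟨_, ⟨l, rfl, rfl⟩, rfl⟩
    exact ⟨l, rfl, (innerProd_prod_idFamily l).symm⟩

/-- The homogeneous components of the elements of `genSubalgebra t`. -/
theorem innerProd_one_mem_wordSpan {t : ℕ → OuterAlg K} (ht : IsGrouplike t) (n : ℕ)
    {y : OuterAlg K} (hy : y ∈ genSubalgebra t) :
    innerProd K (ofPerm K (1 : Equiv.Perm (Fin n))) (toKS y) ∈ wordSpan t n := by
  rw [← toKS_mem_iSup_wordSpan_iff] at hy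
  have : (⨆ n, wordSpan t n) ≤
      (wordSpan t n).comap (innerProd K (ofPerm K (1 : Equiv.Perm (Fin n)))) := by
    refine iSup_le fun m x hx => ?_
    rw [Submodule.mem_comap]
    by_cases h : m = n
    · subst h
      rwa [innerProd_ofPerm_one (ht.wordSpan_le m hx)]
    · rw [innerProd_ofPerm_of_mem_degreePart_ne h _ (ht.wordSpan_le m hx)]
      exact zero_mem _
  exact this hy

theorem inner_idFamily_mem {t : ℕ → OuterAlg K} (ht : IsGrouplike t) (n : ℕ)
    {y : OuterAlg K} (hy : y ∈ genSubalgebra t) :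
    inner K (idFamily K n) y ∈ genSubalgebra t := by
  rw [← toKS_mem_iSup_wordSpan_iff]
  exact Submodule.mem_iSup_of_mem n (innerProd_one_mem_wordSpan ht n hy)

/-- The splitting formula removes the first factor at the cost of taking the coproduct of `y`, which
stays in the tensor square of the subalgebra. A single identity merely projects to a homogeneous
component. -/
theorem inner_prod_idFamily_mem {t : ℕ → OuterAlg K} (ht : IsGrouplike t) (l : List ℕ)
    {y : OuterAlg K} (hy : y ∈ genSubalgebra t) :
    inner K (l.map (idFamily K)).prod y ∈ genSubalgebra t := by
  induction l generalizing y with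
  | nil => exact inner_idFamily_mem ht 0 hy
  | cons a l ih =>
    have hs : IsSplit y (genTensorVal t (ht.comul ⟨y, hy⟩)) := by
      rw [ht.genTensorVal_comul]
      exact ht.genSubalgebra_le hy
    rw [List.map_cons, List.prod_cons, hs.inner_mul]
    generalize ht.comul ⟨y, hy⟩ = z
    induction z using TensorProduct.induction_on with
    | zero => simp
    | add z z' h h' => rw [map_add, map_add, map_add]; exact add_mem h h'
    | tmul x x' => exact mul_mem (inner_idFamily_mem ht a x.2) (ih x'.2)

/-- Solomon's theorem: the descent algebra is closed under the inner product. -/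
theorem innerProd_mem_descentAlg {n : ℕ} {x y : KS K} (hx : x ∈ descentAlg K n)
    (hy : y ∈ descentAlg K n) : innerProd K x y ∈ descentAlg K n := by
  rw [← wordSpan_idFamily] at hx hy ⊢
  rw [wordSpan] at hx
  induction hx using Submodule.span_induction with
  | mem x hx =>
    obtain ⟨l, rfl, rfl⟩ := hx
    have hy' : toKS.symm y ∈ genSubalgebra (idFamily K) := by
      rw [← toKS_mem_iSup_wordSpan_iff]
      exact Submodule.mem_iSup_of_mem _ hy
    have h := innerProd_one_mem_wordSpan isGrouplike_idFamily l.sum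
      (inner_prod_idFamily_mem isGrouplike_idFamily l hy')
    rwa [toKS_inner, innerProd_ofPerm_one (innerProd_mem_degreePart
      (isGrouplike_idFamily.prod_mem_degreePart l))] at h
  | zero => simp
  | add x x' _ _ h h' => rw [map_add, LinearMap.add_apply]; exact add_mem h h'
  | smul c x _ h => rw [map_smul, LinearMap.smul_apply]; exact Submodule.smul_mem _ c h

theorem one_mem_descentAlg (n : ℕ) : ofPerm K (1 : Equiv.Perm (Fin n)) ∈ descentAlg K n := by
  rw [← wordSpan_idFamily]
  refine Submodule.subset_span ⟨[n], List.sum_singleton, ?_⟩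
  rw [List.map_singleton, List.prod_singleton, idFamily, LinearEquiv.apply_symm_apply]

theorem innerProd_mem_peakAlg [CharZero K] {n : ℕ} {x y : KS K} (hx : x ∈ descentAlg K n)
    (hy : y ∈ peakAlg K n) : innerProd K x y ∈ peakAlg K n := by
  rw [peakAlg_eq_map, Submodule.mem_map] at hy ⊢
  obtain ⟨z, hz, rfl⟩ := hy
  refine ⟨innerProd K x z, innerProd_mem_descentAlg hx hz, ?_⟩
  rw [LinearMap.flip_apply, LinearMap.flip_apply, innerProd_assoc]

theorem isLeftIdealOf_peakAlg [CharZero K] (n : ℕ) :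
    IsLeftIdealOf K n (peakAlg K n) (descentAlg K n) :=
  ⟨one_mem_descentAlg n, fun _ hx _ hy => innerProd_mem_descentAlg hx hy,
    peakAlg_le_descentAlg n, fun _ hx _ hy => innerProd_mem_peakAlg hx hy⟩

end Families

end PeakAlgebra

end

/-! ### The epimorphism, the left ideals and the images of the `Ξ^q` -/

theorem theorem5 (K : Type u) [Field K] [CharZero K] :
    -- a graded epimorphism of bialgebras
    (∃ (A : Type u) (_ : Ring A) (_ : Bialgebra K A) (eA : A →ₗ[K] PeakAlgebra.KS K)
        (B : Type u) (_ : Ring B) (_ : Bialgebra K B) (eB : B →ₗ[K] PeakAlgebra.KS K)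
        (f : A →ₐc[K] B),
        PeakAlgebra.IsGradedBialgebra K (PeakAlgebra.descentAlg K) A eA ∧
        PeakAlgebra.IsGradedBialgebra K (PeakAlgebra.peakAlg K) B eB ∧
        (∀ a : A, eB (f a) = PeakAlgebra.rightMul K (PeakAlgebra.tXiNat K) (eA a)) ∧
        (∀ (n : ℕ) (a : A), eA a ∈ PeakAlgebra.descentAlg K n →
          eB (f a) ∈ PeakAlgebra.peakAlg K n) ∧
        Function.Surjective f) ∧
    -- the peak algebra as a left ideal
    (∀ n : ℕ,
      PeakAlgebra.peakAlg K n =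
        (PeakAlgebra.descentAlg K n).map
          ((PeakAlgebra.innerProd K).flip (PeakAlgebra.tXiNat K n)) ∧
      PeakAlgebra.IsLeftIdealOf K n (PeakAlgebra.peakAlg K n) (PeakAlgebra.descentAlg K n)) ∧
    -- the images of the basis elements
    (∀ (n : ℕ) (q : Composition n),
      PeakAlgebra.tXi K q = PeakAlgebra.innerProd K (PeakAlgebra.Xi K q) (PeakAlgebra.tXiNat K n)) := by
  open PeakAlgebra in
  refine ⟨?_, fun n => ⟨peakAlg_eq_map n, isLeftIdealOf_peakAlg n⟩, fun n q => ?_⟩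
  · have hs := isGrouplike_idFamily (K := K)
    have ht := isGrouplike_tXiFamily (K := K)
    obtain ⟨f, hf, hsurj⟩ := exists_bialgHom hs ht ht.rightMulHom rightMulHom_idFamily
    have hD : wordSpan (idFamily K) = descentAlg K := funext wordSpan_idFamily
    have hP : wordSpan (tXiFamily K) = peakAlg K := funext wordSpan_tXiFamily
    have hfe : ∀ a, genIncl (tXiFamily K) (f a) =
        rightMul K (tXiNat K) (genIncl (idFamily K) a) := fun a => by
      rw [genIncl_apply, hf]
      rfl
    have hA := hs.isGradedBialgebra
    rw [hD] at hA
    have hB := ht.isGradedBialgebra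
    rw [hP] at hB
    have hdeg : ∀ (n : ℕ) (a : genSubalgebra (idFamily K)),
        genIncl (idFamily K) a ∈ descentAlg K n →
          genIncl (tXiFamily K) (f a) ∈ peakAlg K n := fun n a ha => by
      rw [hfe, rightMul_of_mem_degreePart (n := n), peakAlg_eq_map]
      · exact ⟨_, ha, rfl⟩
      · rw [← hD] at ha
        exact hs.wordSpan_le n ha
    exact ⟨genSubalgebra (idFamily K), inferInstance, hs.bialgebra, genIncl (idFamily K),
      genSubalgebra (tXiFamily K), inferInstance, ht.bialgebra, genIncl (tXiFamily K), f, hA, hB,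
      hfe, hdeg, hsurj⟩
  · obtain ⟨l, hpos, rfl⟩ := q
    rw [tXi_eq, Xi_eq]
    exact (innerProd_prod_idFamily l).symm
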